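/- All graphs are finite, simple and undirected. For a graph $G=(V,E)$, $A\subseteq V$ and $v\in V$, let $d_A(v)$ denote the number of neighbours of $v$ in $A$, and let $\partial A$ be the set of vertices outside $A$ with a neighbour in $A$. A set $A\subseteq V$ is an \emph{offensive alliance} if $d_A(v)\ge d_{V\setminus A}(v)+1$ for every $v\in\partial A$. It is \emph{global} if every vertex of $V\setminus A$ has a neighbour in $A$, and \emph{independent} if no two vertices of $A$ are adjacent. A set $A$ is transformed into $B$ by a \emph{token jumping} step (TJ) if $|A|=|B|$ and $|A\setminus B|=1$; this is a \emph{token sliding} step (TS) if moreover the vertex in $A\setminus B$ and the vertex in $B\setminus A$ are adjacent. For $Y\in\{\mathrm{TJ},\mathrm{TS}\}$, \textsc{Global Independent Offensive Alliance Reconfiguration}-$Y$ is the following decision problem: given a graph $G=(V,E)$ and two global independent offensive alliances $A_s,A_t\subseteq V$ of $G$ (the graph being given by its adjacency matrix, the sets by their characteristic vectors), is there a finite sequence $A_s=A_1,\dots,A_\ell=A_t$ of global independent offensive alliances of $G$ such that, for each $1\le i<\ell$, $A_i$ is transformed into $A_{i+1}$ by a $Y$ step? For both $Y=\mathrm{TJ}$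 and $Y=\mathrm{TS}$, \textsc{Global Independent Offensive Alliance Reconfiguration}-$Y$ is in \textsf{LogSPACE}, i.e., the set of encodings of its yes-instances is decided by a deterministic Turing machine that has a read-only input tape, halts on every input, and uses $O(\log n)$ cells of its work tapes on inputs of length $n$. Moreover, if $A$ and $B$ are global independent offensive alliances of a graph $G$ and $A$ is transformed into $B$ by a token jumping step from $v\in A\setminus B$ to $u\in B\setminus A$, then $\{v,u\}$ is an isolated edge of $G$, i.e., $v$ and $u$ are adjacent and both have degree one. -/

import Mathlib

/-! ### Deterministic logarithmic space -/

/-- Contents of a cell of the read-only input tape: a letter, or one of the two end markers. -/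
inductive InputCell (α : Type) where
  | leftEnd
  | letter (a : α)
  | rightEnd

/-- Head movements. -/
inductive HeadMove where
  | left
  | stay
  | right

/-- Deterministic Turing machines with a two-way read-only input tape over the alphabet `α` and
finitely many read-write work tapes, each infinite to the right. From the state, the scanned input
cell and the scanned work cells, `trans` gives the new state, the move of the input head, and, for
each work tape, the letter to be written and the move of its head; the machine halts when `trans`
is undefined (`none`). -/
structure OfflineTM (α : Type) where
  /-- the states -/
  State : Type
  /-- the work alphabet -/
  Work : Type
  /-- there are finitely many states -/
  finState : Finite State
  /-- the work alphabet is finite -/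
  finWork : Finite Work
  /-- the number of work tapes -/
  tapes : ℕ
  /-- the blank letter of the work alphabet -/
  blank : Work
  /-- the start state -/
  start : State
  /-- the accepting states -/
  accept : Set State
  /-- the transition function -/
  trans : State → InputCell α → (Fin tapes → Work) →
    Option (State × HeadMove × (Fin tapes → Work × HeadMove))

namespace OfflineTM

variable {α : Type}

/-- The input tape holding `w`: cell `0` is the left end marker, cells `1, …, |w|` hold the letters
of `w`, and cell `|w| + 1` is the right end marker. -/
def inputCell (w : List α) : ℕ → InputCell α
  | 0 => .leftEnd
  | i + 1 => (w[i]?).elim .rightEnd .letter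

/-- The input head never leaves the cells `0, …, |w| + 1`: a move beyond an end marker leaves it
where it is. -/
def moveInput (w : List α) (p : ℕ) : HeadMove → ℕ
  | .left => p - 1
  | .stay => p
  | .right => min (p + 1) (w.length + 1)

/-- The cells of a work tape are numbered `0, 1, 2, …`; a left move at cell `0` leaves the head
where it is. -/
def moveWork (p : ℕ) : HeadMove → ℕ
  | .left => p - 1
  | .stay => p
  | .right => p + 1

/-- A configuration: state, position of the input head, positions of the work heads, contents of
the work tapes. -/
structure Cfg (M : OfflineTM α) where
  /-- the current state -/
  state : M.State
  /-- the position of the input head -/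
  inputHead : ℕ
  /-- the positions of the heads on the work tapes -/
  head : Fin M.tapes → ℕ
  /-- the contents of the work tapes -/
  tape : Fin M.tapes → ℕ → M.Work

/-- The initial configuration: all heads at cell `0`, all work tapes blank. -/
def initial (M : OfflineTM α) : M.Cfg where
  state := M.start
  inputHead := 0
  head := fun _ => 0
  tape := fun _ _ => M.blank

/-- One step of the computation on the input `w`; `none` if the machine halts. -/
def step (M : OfflineTM α) (w : List α) (c : M.Cfg) : Option M.Cfg :=
  (M.trans c.state (inputCell w c.inputHead) fun i => c.tape i (c.head i)).map fun r =>
    { state := r.1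
      inputHead := moveInput w c.inputHead r.2.1
      head := fun i => moveWork (c.head i) (r.2.2 i).2
      tape := fun i => Function.update (c.tape i) (c.head i) (r.2.2 i).1 }

/-- `M` accepts or rejects `w` correctly with respect to `L`: the computation on `w` halts, and it
halts in an accepting state exactly when `w ∈ L`. -/
def DecidesOn (M : OfflineTM α) (L : Language α) (w : List α) : Prop :=
  ∃ c : M.Cfg, StateTransition.Reaches (M.step w) M.initial c ∧ M.step w c = none ∧
    (c.state ∈ M.accept ↔ w ∈ L)

/-- During the computation on `w`, the machine visits only the first `s` cells of each work
tape. -/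
def UsesSpaceOn (M : OfflineTM α) (w : List α) (s : ℕ) : Prop :=
  ∀ c : M.Cfg, StateTransition.Reaches (M.step w) M.initial c → ∀ i, c.head i < s

end OfflineTM

/-- The class of languages decided by a deterministic Turing machine that halts on every input and
uses `O(log n)` work cells on inputs of length `n`. -/
def InLogSpace {α : Type} (L : Language α) : Prop :=
  ∃ (M : OfflineTM α) (C : ℕ), ∀ w : List α,
    M.DecidesOn L w ∧ M.UsesSpaceOn w (C * (Nat.log 2 w.length + 1))

/-! ### Alliances and their reconfiguration -/

namespace SimpleGraph

variable {V : Type*} (G : SimpleGraph V)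

/-- `d_A(v)`, the number of neighbours of `v` in `A`. -/
noncomputable def degreeIn (A : Set V) (v : V) : ℕ := (G.neighborSet v ∩ A).ncard

/-- `∂A`, the vertices outside `A` with a neighbour in `A`. -/
def allianceBoundary (A : Set V) : Set V := {v | v ∉ A ∧ ∃ a ∈ A, G.Adj a v}

/-- Offensive alliances: `d_A(v) ≥ d_{V∖A}(v) + 1` for every `v ∈ ∂A`. -/
def IsOffensiveAlliance (A : Set V) : Prop :=
  ∀ v ∈ G.allianceBoundary A, G.degreeIn Aᶜ v + 1 ≤ G.degreeIn A v

/-- Dominating sets: every vertex belongs to `D` or has a neighbour in `D`. -/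
def IsDominatingSet (D : Set V) : Prop := ∀ v, v ∈ D ∨ ∃ u ∈ D, G.Adj u v

/-- Global independent offensive alliances. -/
def IsGlobalIndepOffensiveAlliance (A : Set V) : Prop :=
  G.IsOffensiveAlliance A ∧ G.IsDominatingSet A ∧ G.IsIndepSet A

/-- An isolated edge: an edge joining two vertices of degree one. -/
def IsIsolatedEdge (u v : V) : Prop :=
  G.Adj u v ∧ (G.neighborSet u).ncard = 1 ∧ (G.neighborSet v).ncard = 1

/-- A token jumping step from `A` to `B`. -/
def TokenJump (A B : Set V) : Prop := A.ncard = B.ncard ∧ (A \ B).ncard = 1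

/-- A token sliding step from `A` to `B`: a token jumping step along an edge. -/
def TokenSlide (A B : Set V) : Prop :=
  TokenJump A B ∧ ∀ v ∈ A \ B, ∀ u ∈ B \ A, G.Adj v u

end SimpleGraph

/-- The two reconfiguration rules. -/
inductive TokenRule where
  | jumping
  | sliding

/-- The reconfiguration steps allowed by a rule. -/
def TokenRule.Step {V : Type*} (G : SimpleGraph V) : TokenRule → Set V → Set V → Prop
  | .jumping => SimpleGraph.TokenJump
  | .sliding => G.TokenSlide

/-- There is a finite sequence `S 0 = A, …, S m = B` of global independent offensive alliances of
`G`, each of which is obtained from the previous one by a step of the rule `Y`. -/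
def GlobalIndepOffReconfigurable {V : Type*} (Y : TokenRule) (G : SimpleGraph V)
    (A B : Set V) : Prop :=
  ∃ (m : ℕ) (S : ℕ → Set V), S 0 = A ∧ S m = B ∧
    (∀ i ≤ m, G.IsGlobalIndepOffensiveAlliance (S i)) ∧ ∀ i < m, Y.Step G (S i) (S (i + 1))

open Classical in
/-- The binary encoding of a graph `G` on `{0, …, n - 1}` with two vertex sets: the number `n` in
unary followed by a `0`, the adjacency matrix of `G` row by row, and the characteristic vectors of
`A` and `B`. -/
noncomputable def encodeInstance {n : ℕ} (G : SimpleGraph (Fin n)) (A B : Set (Fin n)) :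
    List Bool :=
  List.replicate n true ++ [false] ++
    List.ofFn (fun p : Fin (n * n) => decide (G.Adj p.divNat p.modNat)) ++
    List.ofFn (fun v : Fin n => decide (v ∈ A)) ++
    List.ofFn (fun v : Fin n => decide (v ∈ B))

/-- Global independent offensive alliance reconfiguration under the rule `Y`, as a language: the
encodings of the triples `(G, A, B)` where `A` and `B` are global independent offensive alliances
of the graph `G` and there is a reconfiguration sequence from `A` to `B`. -/
def globalIndepOffReconfiguration (Y : TokenRule) : Language Bool :=
  {w | ∃ (n : ℕ) (G : SimpleGraph (Fin n)) (A B : Set (Fin n)), w = encodeInstance G A B ∧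
    G.IsGlobalIndepOffensiveAlliance A ∧ G.IsGlobalIndepOffensiveAlliance B ∧
    GlobalIndepOffReconfigurable Y G A B}

/-! ### Reconfiguration of global independent offensive alliances -/

/-! Let `A` and `B` be global independent offensive alliances and `v ∈ A \ B`. Since `B` dominates
`v` and `A` is independent, `v` has a neighbour in `B`, and all such neighbours lie in `B \ A`. If
`B \ A = {u}`, then `v` has exactly one neighbour in `B`, so the alliance inequality for `B` at `v`
reads `d_{V∖B}(v) < 1`, and `u` is the only neighbour of `v`. By symmetry `v` is the only neighbour
of `u`: every jump runs along an isolated edge (`isIsolatedEdge_of_tokenJump`).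

Hence a reconfiguration sequence changes membership only at vertices of degree one. Conversely, if
`A` and `B` differ only at such vertices, each `v ∈ A \ B` has its unique neighbour `u` in `B \ A`,
and sliding the token from `v` to `u` gives an alliance closer to `B`. So under both rules
reachability is equivalent to the local condition `DifferOnLeaves`.

For the space bound, `YesInstance` expresses validity of the word, the two alliance conditions and
the leaf condition through letter lookups at quadratic addresses, Boolean connectives, quantifiers
over numbers below `n`, and comparisons of two counts. All numbers involved are at most `(|w| +
2)^2`, so in binary they occupy `O(log |w|)` cells, one work tape per number. `IsTest` is the class
of predicates computable with such registers; it is closed under these operations, and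
`IsTest.inLogSpace` turns a test into a Turing machine. -/

namespace SimpleGraph

variable {V : Type*} {G : SimpleGraph V} {A B : Set V}

/-- In a finite graph, a global independent offensive alliance is a set whose vertices have no
neighbour in it, and such that every other vertex has more neighbours inside than outside. -/
theorem isGlobalIndepOffensiveAlliance_iff [Finite V] :
    G.IsGlobalIndepOffensiveAlliance A ↔
      (∀ v ∉ A, G.degreeIn Aᶜ v < G.degreeIn A v) ∧ ∀ v ∈ A, ∀ u ∈ A, ¬ G.Adj v u := by
  constructor
  · rintro ⟨hoff, hdom, hind⟩
    refine ⟨fun v hv => hoff v ⟨hv, (hdom v).resolve_left hv⟩, fun v hv u hu huv => ?_⟩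
    exact hind hv hu huv.ne huv
  · rintro ⟨hout, hin⟩
    refine ⟨fun v hv => hout v hv.1, fun v => ?_, fun v hv u hu _ => hin v hv u hu⟩
    by_cases hv : v ∈ A
    · exact Or.inl hv
    · have hpos : 0 < G.degreeIn A v := (Nat.zero_le _).trans_lt (hout v hv)
      obtain ⟨u, hu, huA⟩ := (Set.ncard_pos (Set.toFinite _)).1 hpos
      exact Or.inr ⟨u, huA, G.adj_symm hu⟩

/-- `B` dominates `v`, and independence of `A` keeps the dominating neighbour out of `A`. -/
theorem IsGlobalIndepOffensiveAlliance.adj_of_mem_diff [Finite V]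
    (hA : G.IsGlobalIndepOffensiveAlliance A) (hB : G.IsGlobalIndepOffensiveAlliance B)
    {v : V} (hv : v ∈ A \ B) : ∃ u ∈ B \ A, G.Adj v u := by
  obtain ⟨u, hu, huv⟩ := (hB.2.1 v).resolve_left hv.2
  exact ⟨u, ⟨hu, fun huA => hA.2.2 huA hv.1 huv.ne huv⟩, huv.symm⟩

/-- If `u` is the only vertex of `B` outside `A`, then a vertex of `A \ B` has no neighbour other
than `u`. -/
theorem IsGlobalIndepOffensiveAlliance.neighborSet_eq_of_diff_eq [Finite V]
    (hA : G.IsGlobalIndepOffensiveAlliance A) (hB : G.IsGlobalIndepOffensiveAlliance B)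
    {u v : V} (hv : v ∈ A \ B) (hu : B \ A = {u}) : G.neighborSet v = {u} := by
  have hsub : G.neighborSet v ∩ B = {u} := by
    obtain ⟨x, hx, hvx⟩ := hA.adj_of_mem_diff hB hv
    ext y
    constructor
    · rintro ⟨hvy, hyB⟩
      rw [← hu]
      exact ⟨hyB, fun hyA => hA.2.2 hv.1 hyA (G.ne_of_adj hvy) hvy⟩
    · rintro rfl
      rw [hu] at hx
      obtain rfl := hx
      exact ⟨hvx, (hu.symm.subset rfl).1⟩
  -- As `v` has exactly one neighbour in `B`, the strict inequality leaves none outside `B`.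
  have hlt := (isGlobalIndepOffensiveAlliance_iff.1 hB).1 v hv.2
  rw [degreeIn, degreeIn, hsub, Set.ncard_singleton, Nat.lt_one_iff,
    Set.ncard_eq_zero (Set.toFinite _)] at hlt
  rw [← hsub, ← Set.inter_union_compl (G.neighborSet v) B, hlt, Set.union_empty]
  simp

theorem TokenJump.exists_diff_eq [Finite V] (h : TokenJump A B) :
    ∃ v u, A \ B = {v} ∧ B \ A = {u} := by
  obtain ⟨v, hv⟩ := Set.ncard_eq_one.1 h.2
  have hBA : (B \ A).ncard = 1 := by
    have h1 := Set.ncard_inter_add_ncard_sdiff_eq_ncard A B (Set.toFinite _)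
    have h2 := Set.ncard_inter_add_ncard_sdiff_eq_ncard B A (Set.toFinite _)
    rw [Set.inter_comm] at h2
    have := h.1
    have := h.2
    omega
  obtain ⟨u, hu⟩ := Set.ncard_eq_one.1 hBA
  exact ⟨v, u, hv, hu⟩

/-- Both differences are singletons, so `neighborSet_eq_of_diff_eq` applies with `A` and `B` in
either order. -/
theorem IsGlobalIndepOffensiveAlliance.isIsolatedEdge_of_tokenJump [Finite V]
    (hA : G.IsGlobalIndepOffensiveAlliance A) (hB : G.IsGlobalIndepOffensiveAlliance B)
    (h : TokenJump A B) {v u : V} (hv : v ∈ A \ B) (hu : u ∈ B \ A) : G.IsIsolatedEdge v u := by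
  obtain ⟨v', u', hAB, hBA⟩ := h.exists_diff_eq
  obtain rfl : v = v' := by simpa [hAB] using hv
  obtain rfl : u = u' := by simpa [hBA] using hu
  have h1 := hA.neighborSet_eq_of_diff_eq hB hv hBA
  have h2 := hB.neighborSet_eq_of_diff_eq hA hu hAB
  refine ⟨?_, by rw [h1, Set.ncard_singleton], by rw [h2, Set.ncard_singleton]⟩
  rw [← mem_neighborSet, h1]
  rfl

/-- The sets `A` and `B` differ only in vertices of degree one. -/
def DifferOnLeaves (G : SimpleGraph V) (A B : Set V) : Prop :=
  ∀ v, (v ∈ A ↔ v ∈ B) ∨ (G.neighborSet v).ncard = 1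

end SimpleGraph

/-! ### Reachability under either rule means differing only in vertices of degree one -/

section Reconfiguration

open SimpleGraph

variable {V : Type*} {G : SimpleGraph V} {A B : Set V} {Y : TokenRule}

theorem TokenRule.Step.tokenJump (h : Y.Step G A B) : TokenJump A B := by
  cases Y
  · exact h
  · exact h.1

/-- Each step alters membership only at the two ends of an isolated edge, so a vertex of any other
degree keeps its status along the whole sequence. -/
theorem GlobalIndepOffReconfigurable.differOnLeaves [Finite V]
    (h : GlobalIndepOffReconfigurable Y G A B) : G.DifferOnLeaves A B := by
  obtain ⟨m, S, rfl, rfl, hS, hstep⟩ := h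
  have key : ∀ k ≤ m, G.DifferOnLeaves (S 0) (S k) := by
    intro k
    induction k with
    | zero => exact fun _ v => Or.inl Iff.rfl
    | succ k ih =>
      intro hk v
      have hj := (hstep k (by omega)).tokenJump
      obtain ⟨x, y, hx, hy⟩ := hj.exists_diff_eq
      have hiso := (hS k (by omega)).isIsolatedEdge_of_tokenJump (hS (k + 1) hk) hj
        (v := x) (u := y) (by rw [hx]; rfl) (by rw [hy]; rfl)
      by_cases hvx : v ∈ S k \ S (k + 1)
      · rw [hx] at hvx
        obtain rfl := hvx
        exact Or.inr hiso.2.1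
      by_cases hvy : v ∈ S (k + 1) \ S k
      · rw [hy] at hvy
        obtain rfl := hvy
        exact Or.inr hiso.2.2
      · refine (ih (by omega) v).imp_left fun h => h.trans ⟨fun h' => ?_, fun h' => ?_⟩
        · by_contra h''
          exact hvx ⟨h', h''⟩
        · by_contra h''
          exact hvy ⟨h', h''⟩
  exact key m le_rfl

/-- Sliding the token on `v` along an isolated edge `{v, u}` gives a global independent offensive
alliance again. -/
theorem SimpleGraph.IsGlobalIndepOffensiveAlliance.slide [Finite V]
    (hA : G.IsGlobalIndepOffensiveAlliance A) {v u : V} (hv : v ∈ A) (hu : u ∉ A)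
    (hNv : G.neighborSet v = {u}) (hNu : G.neighborSet u = {v}) :
    G.IsGlobalIndepOffensiveAlliance (insert u (A \ {v})) := by
  rw [isGlobalIndepOffensiveAlliance_iff] at hA ⊢
  have hvu : ∀ x, G.Adj v x ↔ x = u := fun x => by
    rw [← mem_neighborSet, hNv, Set.mem_singleton_iff]
  have huv : ∀ x, G.Adj u x ↔ x = v := fun x => by
    rw [← mem_neighborSet, hNu, Set.mem_singleton_iff]
  have hne : u ≠ v := fun h => hu (h ▸ hv)
  constructor
  · intro x hx
    by_cases hxv : x = v
    · subst hxv
      rw [degreeIn, degreeIn, hNv]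
      have h1 : ({u} ∩ (insert u (A \ {x}))ᶜ : Set V) = ∅ := by
        ext y; simp +contextual
      have h2 : ({u} ∩ insert u (A \ {x}) : Set V) = {u} := by
        ext y; simp +contextual
      rw [h1, h2]
      simp
    · have hxu : x ≠ u := fun h => hx (Or.inl h)
      have hxA : x ∉ A := fun h => hx (Or.inr ⟨h, hxv⟩)
      -- As `{v, u}` is an isolated edge, `x` sees neither end, so its two counts are those for `A`.
      have h1 : ¬ G.Adj x v := fun h => hxu ((hvu x).1 h.symm)
      have h2 : ¬ G.Adj x u := fun h => hxv ((huv x).1 h.symm)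
      have e1 : G.neighborSet x ∩ insert u (A \ {v}) = G.neighborSet x ∩ A := by
        ext y
        simp only [Set.mem_inter_iff, mem_neighborSet, Set.mem_insert_iff, Set.mem_sdiff,
          Set.mem_singleton_iff]
        refine and_congr_right fun hy => ?_
        have hyv : y ≠ v := by rintro rfl; exact h1 hy
        have hyu : y ≠ u := by rintro rfl; exact h2 hy
        simp [hyv, hyu]
      have e2 : G.neighborSet x ∩ (insert u (A \ {v}))ᶜ = G.neighborSet x ∩ Aᶜ := by
        rw [← Set.sdiff_eq, ← Set.sdiff_eq, ← Set.sdiff_self_inter, e1, Set.sdiff_self_inter]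
      have := hA.1 x hxA
      rwa [degreeIn, degreeIn, e1, e2]
  · rintro x (rfl | ⟨hx, hxv⟩) y (rfl | ⟨hy, hyv⟩) hxy
    · exact hxy.ne rfl
    · exact hyv ((huv y).1 hxy)
    · exact hxv ((huv x).1 hxy.symm)
    · exact hA.2 x hx y hy hxy

theorem GlobalIndepOffReconfigurable.refl (hA : G.IsGlobalIndepOffensiveAlliance A) :
    GlobalIndepOffReconfigurable Y G A A :=
  ⟨0, fun _ => A, rfl, rfl, fun _ _ => hA, fun _ h => absurd h (Nat.not_lt_zero _)⟩

theorem GlobalIndepOffReconfigurable.cons {C : Set V} (hA : G.IsGlobalIndepOffensiveAlliance A)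
    (hAC : Y.Step G A C) (h : GlobalIndepOffReconfigurable Y G C B) :
    GlobalIndepOffReconfigurable Y G A B := by
  obtain ⟨m, S, rfl, hm, hS, hstep⟩ := h
  refine ⟨m + 1, fun i => i.casesOn A S, rfl, hm, ?_, ?_⟩
  · rintro (_ | i) hi
    · exact hA
    · exact hS i (by omega)
  · rintro (_ | i) hi
    · exact hAC
    · exact hstep i (by omega)

/-- Induction on `|A \ B|`. A vertex `v ∈ A \ B` has a neighbour `u ∈ B \ A`; both have degree one
by hypothesis, so the token on `v` can slide to `u`. This is a step of both rules, and it removes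
`v` from the difference without adding to it. -/
theorem SimpleGraph.DifferOnLeaves.reconfigurable [Finite V] (h : G.DifferOnLeaves A B)
    (hA : G.IsGlobalIndepOffensiveAlliance A) (hB : G.IsGlobalIndepOffensiveAlliance B) :
    GlobalIndepOffReconfigurable Y G A B := by
  induction hk : (A \ B).ncard generalizing A with
  | zero =>
    rw [Set.ncard_eq_zero (Set.toFinite _)] at hk
    -- A vertex of `B \ A` would have a neighbour in `A \ B`, which is empty.
    have hBA : B \ A = ∅ := by
      by_contra hne
      obtain ⟨v, hv⟩ := Set.nonempty_iff_ne_empty.2 hne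
      obtain ⟨u, hu, -⟩ := hB.adj_of_mem_diff hA hv
      rw [hk] at hu
      exact hu
    obtain rfl : A = B :=
      (Set.sdiff_eq_empty.1 hk).antisymm (Set.sdiff_eq_empty.1 hBA)
    exact .refl hA
  | succ k ih =>
    obtain ⟨v, hv⟩ := (Set.ncard_pos (Set.toFinite (A \ B))).1 (by omega)
    obtain ⟨u, hu, hvu⟩ := hA.adj_of_mem_diff hB hv
    -- Where `A` and `B` differ the degree is one, so any known neighbour is the only one.
    have leaf : ∀ x y, G.Adj x y → ¬ (x ∈ A ↔ x ∈ B) → G.neighborSet x = {y} := by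
      intro x y hxy hx
      obtain ⟨z, hz⟩ := Set.ncard_eq_one.1 ((h x).resolve_left hx)
      have : y ∈ G.neighborSet x := hxy
      rw [hz] at this ⊢
      rw [Set.mem_singleton_iff.1 this]
    have hNv := leaf v u hvu fun hiff => hv.2 (hiff.1 hv.1)
    have hNu := leaf u v hvu.symm fun hiff => hu.2 (hiff.2 hu.1)
    have hC := hA.slide hv.1 hu.2 hNv hNu
    have hne : u ≠ v := hvu.ne'
    have d1 : A \ insert u (A \ {v}) = {v} := by
      ext x
      simp only [Set.mem_sdiff, Set.mem_insert_iff, Set.mem_singleton_iff, not_or, not_and, not_not]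
      constructor
      · exact fun hx => hx.2.2 hx.1
      · rintro rfl
        exact ⟨hv.1, hne.symm, fun _ => rfl⟩
    have d2 : insert u (A \ {v}) \ A = {u} := by
      ext x
      simp only [Set.mem_sdiff, Set.mem_insert_iff, Set.mem_singleton_iff]
      constructor
      · rintro ⟨hx | hx, hxA⟩
        · exact hx
        · exact absurd hx.1 hxA
      · rintro rfl
        exact ⟨Or.inl rfl, hu.2⟩
    have hjump : TokenJump A (insert u (A \ {v})) := by
      refine ⟨?_, by rw [d1, Set.ncard_singleton]⟩
      exact (Set.ncard_exchange hu.2 hv.1).symm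
    have hstep : Y.Step G A (insert u (A \ {v})) := by
      cases Y
      · exact hjump
      · refine ⟨hjump, fun x hx y hy => ?_⟩
        rw [d1] at hx
        rw [d2] at hy
        obtain rfl := hx
        obtain rfl := hy
        exact hvu
    refine .cons hA hstep (ih (fun x => ?_) hC ?_)
    -- The new set still differs from `B` only on leaves: the slide changed membership only at `v`
    -- and `u`, which have degree one.
    · by_cases hxv : x = v
      · subst hxv
        exact Or.inr (by rw [hNv, Set.ncard_singleton])
      by_cases hxu : x = u
      · subst hxu
        exact Or.inr (by rw [hNu, Set.ncard_singleton])
      · simpa [hxv, hxu] using h x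
    · have : insert u (A \ {v}) \ B = (A \ B) \ {v} := by
        ext x
        simp only [Set.mem_sdiff, Set.mem_insert_iff, Set.mem_singleton_iff]
        constructor
        · rintro ⟨rfl | hx, hxB⟩
          · exact absurd hu.1 hxB
          · exact ⟨⟨hx.1, hxB⟩, hx.2⟩
        · rintro ⟨⟨hx, hxB⟩, hxv⟩
          exact ⟨Or.inr ⟨hx, hxv⟩, hxB⟩
      rw [this, Set.ncard_sdiff_singleton_of_mem hv, hk]
      rfl

end Reconfiguration

/-! ### Structured programs for Turing machines -/

/-- The letters on the work tapes: blank (`none`), a left end marker (`some none`), and the binary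
digits (`some (some b)`). -/
abbrev WorkLetter := Option (Option Bool)

/-- The part of a configuration other than the state. -/
@[ext]
structure Store (K : ℕ) where
  inputHead : ℕ
  head : Fin K → ℕ
  tape : Fin K → ℕ → WorkLetter

/-- What a machine with `K` work tapes does in one step, apart from changing its state. -/
abbrev TapeAction (K : ℕ) := HeadMove × (Fin K → WorkLetter × HeadMove)

namespace Store

variable {K : ℕ}

/-- The scanned work letters. -/
def scan (d : Store K) : Fin K → WorkLetter := fun i => d.tape i (d.head i)

/-- The effect of an action. -/
def act (w : List Bool) (d : Store K) (a : TapeAction K) : Store K where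
  inputHead := OfflineTM.moveInput w d.inputHead a.1
  head := fun i => OfflineTM.moveWork (d.head i) (a.2 i).2
  tape := fun i => Function.update (d.tape i) (d.head i) (a.2 i).1

/-- All heads are on the first `s` cells. -/
def Within (s : ℕ) (d : Store K) : Prop := ∀ i, d.head i < s

end Store

/-- A finite control with `K` work tapes and two exits, `true` and `false`. -/
structure Routine (K : ℕ) where
  State : Type
  finState : Finite State
  start : State
  trans : State → InputCell Bool → (Fin K → WorkLetter) → (State ⊕ Bool) × TapeAction K

namespace Routine

variable {K : ℕ}

/-- On the input `w`, the routine `R`, entered in the state `q` with the store `d`, leaves by the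
exit `b` with the store `d'`, and until then its heads stay on the first `s` cells. -/
inductive Runs (R : Routine K) (w : List Bool) (s : ℕ) :
    R.State → Store K → Bool → Store K → Prop
  | exit {q : R.State} {d : Store K} {b : Bool} {a : TapeAction K} (hs : d.Within s)
      (h : R.trans q (OfflineTM.inputCell w d.inputHead) d.scan = (.inr b, a)) :
      Runs R w s q d b (d.act w a)
  | step {q q' : R.State} {d d' : Store K} {b : Bool} {a : TapeAction K} (hs : d.Within s)
      (h : R.trans q (OfflineTM.inputCell w d.inputHead) d.scan = (.inl q', a))
      (h' : Runs R w s q' (d.act w a) b d') : Runs R w s q d b d'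

variable {w : List Bool} {s : ℕ}

/-- `Runs.exit` ends in the literal store `d.act w a`; here the final store may have any form proved
equal to it, such as `Memory.focus` or `Memory.withHeads`. -/
theorem Runs.exit_of_eq {R : Routine K} {q : R.State} {d d' : Store K} {b : Bool} (a : TapeAction K)
    (hs : d.Within s)
    (h : R.trans q (OfflineTM.inputCell w d.inputHead) d.scan = (.inr b, a))
    (hd : d.act w a = d') : R.Runs w s q d b d' :=
  hd ▸ .exit hs h

theorem Runs.step_of_eq {R : Routine K} {q : R.State} (q' : R.State) {d d' : Store K} (d₁ : Store K)
    {b : Bool} (a : TapeAction K) (hs : d.Within s)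
    (h : R.trans q (OfflineTM.inputCell w d.inputHead) d.scan = (.inl q', a))
    (hd : d.act w a = d₁) (h' : R.Runs w s q' d₁ b d') : R.Runs w s q d b d' :=
  .step hs h (hd ▸ h')

/-- Run `R`, then `A` or `B`, according to the exit of `R`. -/
def branch (R A B : Routine K) : Routine K where
  State := R.State ⊕ (A.State ⊕ B.State)
  finState := have := R.finState; have := A.finState; have := B.finState; inferInstance
  start := .inl R.start
  trans
    | .inl q, c, t =>
      ((R.trans q c t).1.elim (fun q' => .inl (.inl q'))
        (fun b => .inl (.inr (bif b then .inl A.start else .inr B.start))), (R.trans q c t).2)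
    | .inr (.inl q), c, t =>
      ((A.trans q c t).1.map (fun q' => .inr (.inl q')) id, (A.trans q c t).2)
    | .inr (.inr q), c, t =>
      ((B.trans q c t).1.map (fun q' => .inr (.inr q')) id, (B.trans q c t).2)

theorem Runs.branch_left {R A B : Routine K} {q : A.State} {d d' : Store K} {b : Bool}
    (h : A.Runs w s q d b d') : (branch R A B).Runs w s (.inr (.inl q)) d b d' := by
  induction h with
  | exit hs h => exact .exit hs (by simp [branch, h])
  | step hs h _ ih => exact .step hs (by simp only [branch, h]; rfl) ih

theorem Runs.branch_right {R A B : Routine K} {q : B.State} {d d' : Store K} {b : Bool}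
    (h : B.Runs w s q d b d') : (branch R A B).Runs w s (.inr (.inr q)) d b d' := by
  induction h with
  | exit hs h => exact .exit hs (by simp [branch, h])
  | step hs h _ ih => exact .step hs (by simp only [branch, h]; rfl) ih

theorem Runs.branch {R A B : Routine K} {q : R.State} {d d₁ d' : Store K} {b b' : Bool}
    (h : R.Runs w s q d b d₁)
    (h' : (bif b then A else B).Runs w s (bif b then A else B).start d₁ b' d') :
    (branch R A B).Runs w s (.inl q) d b' d' := by
  induction h with
  | @exit q d b a hs h =>
    refine .step (q' := (Sum.inr (bif b then .inl A.start else .inr B.start) :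
      R.State ⊕ (A.State ⊕ B.State))) hs
      (by simp only [Routine.branch, h]; rfl) ?_
    cases b
    · exact h'.branch_right
    · exact h'.branch_left
  | step hs h _ ih => exact .step hs (by simp only [Routine.branch, h]; rfl) (ih h')

/-- Run `C`; stop if it leaves by the exit `true`, otherwise run `A` and start again. -/
def repeatUntil (C A : Routine K) : Routine K where
  State := C.State ⊕ A.State
  finState := have := C.finState; have := A.finState; inferInstance
  start := .inl C.start
  trans
    | .inl q, c, t =>
      ((C.trans q c t).1.elim (fun q' => .inl (.inl q'))
        (fun b => bif b then .inr true else .inl (.inr A.start)), (C.trans q c t).2)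
    | .inr q, c, t =>
      ((A.trans q c t).1.elim (fun q' => .inl (.inr q')) (fun _ => .inl (.inl C.start)),
        (A.trans q c t).2)

theorem Runs.repeatUntil_exit {C A : Routine K} {q : C.State} {d d' : Store K}
    (h : C.Runs w s q d true d') : (C.repeatUntil A).Runs w s (.inl q) d true d' := by
  generalize hb : true = b at h
  induction h with
  | exit hs h => subst hb; exact .exit hs (by simp [Routine.repeatUntil, h])
  | step hs h _ ih => exact .step hs (by simp only [Routine.repeatUntil, h]; rfl) (ih hb)

theorem Runs.repeatUntil_body {C A : Routine K} {q : A.State} {d d₁ d' : Store K} {b : Bool}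
    (h : A.Runs w s q d b d₁) (h' : (C.repeatUntil A).Runs w s (.inl C.start) d₁ true d') :
    (C.repeatUntil A).Runs w s (.inr q) d true d' := by
  induction h with
  | exit hs h => exact .step hs (by simp only [Routine.repeatUntil, h]; rfl) h'
  | step hs h _ ih => exact .step hs (by simp only [Routine.repeatUntil, h]; rfl) (ih h')

theorem Runs.repeatUntil_continue {C A : Routine K} {q : C.State} {d d₁ d' : Store K}
    (h : C.Runs w s q d false d₁) (h' : (C.repeatUntil A).Runs w s (.inr A.start) d₁ true d') :
    (C.repeatUntil A).Runs w s (.inl q) d true d' := by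
  generalize hb : false = b at h
  induction h with
  | exit hs h => subst hb; exact .step hs (by simp only [Routine.repeatUntil, h]; rfl) h'
  | step hs h _ ih => exact .step hs (by simp only [Routine.repeatUntil, h]; rfl) (ih h' hb)

/-- The routine that takes one step, as given by `f`. -/
def single (f : InputCell Bool → (Fin K → WorkLetter) → Bool × TapeAction K) : Routine K where
  State := Unit
  finState := inferInstance
  start := ()
  trans _ c t := (.inr (f c t).1, (f c t).2)

theorem runs_single {f : InputCell Bool → (Fin K → WorkLetter) → Bool × TapeAction K} {d : Store K}
    (hs : d.Within s) {b : Bool} {a : TapeAction K}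
    (h : f (OfflineTM.inputCell w d.inputHead) d.scan = (b, a)) :
    (single f).Runs w s (single f).start d b (d.act w a) :=
  .exit hs (by simp [single, h])

/-- The Turing machine that runs `R` and accepts if `R` leaves by the exit `true`. -/
def toOfflineTM (R : Routine K) : OfflineTM Bool where
  State := R.State ⊕ Bool
  Work := WorkLetter
  finState := have := R.finState; inferInstance
  finWork := inferInstance
  tapes := K
  blank := none
  start := .inl R.start
  accept := {.inr true}
  trans
    | .inl q, c, t => some (R.trans q c t)
    | .inr _, _, _ => none

/-- The configuration with a given state and store. -/
def cfg (R : Routine K) (q : R.State ⊕ Bool) (d : Store K) : R.toOfflineTM.Cfg where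
  state := q
  inputHead := d.inputHead
  head := d.head
  tape := d.tape

theorem step_cfg {R : Routine K} {q : R.State} {q' : R.State ⊕ Bool} {d : Store K} {a : TapeAction K}
    (h : R.trans q (OfflineTM.inputCell w d.inputHead) d.scan = (q', a)) :
    R.toOfflineTM.step w (R.cfg (.inl q) d) = some (R.cfg q' (d.act w a)) := by
  have : R.toOfflineTM.trans (.inl q) (OfflineTM.inputCell w d.inputHead) d.scan = some (q', a) :=
    congrArg some h
  rw [OfflineTM.step]
  change Option.map _ (R.toOfflineTM.trans (.inl q) (OfflineTM.inputCell w d.inputHead) d.scan) = _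
  rw [this]
  rfl

/-- A terminating run of a routine is the whole computation of its machine. -/
theorem Runs.toOfflineTM {R : Routine K} {q : R.State} {d d' : Store K} {b : Bool}
    (h : R.Runs w s q d b d') (hd' : d'.Within s) :
    StateTransition.Reaches (R.toOfflineTM.step w) (R.cfg (.inl q) d) (R.cfg (.inr b) d') ∧
    ∀ c, StateTransition.Reaches (R.toOfflineTM.step w) (R.cfg (.inl q) d) c →
      ∀ i, c.head i < s := by
  induction h with
  | exit hs h =>
    refine ⟨.single (step_cfg h), fun c hc => ?_⟩
    rcases hc.cases_head with rfl | ⟨c', hc', hc''⟩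
    · exact hs
    -- The machine is deterministic, so everything reachable later is reachable from this one
    -- successor.
    · obtain rfl := Option.some.inj ((step_cfg h).symm.trans hc')
      rcases hc''.cases_head with rfl | ⟨c'', h'', -⟩
      · exact hd'
      · exact absurd (show none = some c'' from h'') (by simp)
  | step hs h _ ih =>
    refine ⟨.head (step_cfg h) (ih hd').1, fun c hc => ?_⟩
    rcases hc.cases_head with rfl | ⟨c', hc', hc''⟩
    · exact hs
    · obtain rfl := Option.some.inj ((step_cfg h).symm.trans hc')
      exact (ih hd').2 c hc''

end Routine

/-! ### Registers holding natural numbers in binary -/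

/-- The digits, least significant first, of the successor of a number given by its digits. -/
def incrDigits : List Bool → List Bool
  | [] => [true]
  | false :: l => true :: l
  | true :: l => false :: incrDigits l

theorem bits_succ (x : ℕ) : (x + 1).bits = incrDigits x.bits := by
  induction x using Nat.strong_induction_on with
  | _ x ih =>
    rcases Nat.even_or_odd' x with ⟨k, rfl | rfl⟩
    · rcases Nat.eq_zero_or_pos k with rfl | hk
      · simp [incrDigits]
      · rw [Nat.bit1_bits, Nat.bit0_bits _ hk.ne', incrDigits]
    · rw [Nat.bit1_bits, incrDigits, ← ih k (by omega), ← Nat.bit0_bits (k + 1) (by omega)]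
      rfl

theorem bits_injective : Function.Injective Nat.bits := fun x y h =>
  Nat.eq_of_testBit_eq fun i => by rw [Nat.testBit_eq_inth, Nat.testBit_eq_inth, h]

theorem length_bits_mono {x y : ℕ} (h : x ≤ y) : x.bits.length ≤ y.bits.length := by
  rw [Nat.size_eq_bits_len, Nat.size_eq_bits_len]
  exact Nat.size_le_size h

/-- The work tape holding the end marker and the digits `l`. -/
def digitTape (l : List Bool) : ℕ → WorkLetter
  | 0 => some none
  | j + 1 => l[j]?.map some

/-- The marker occurs in cell `0` only, so a head moving left can tell when it is back. -/
theorem digitTape_eq_mark_iff {l : List Bool} {j : ℕ} : digitTape l j = some none ↔ j = 0 := by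
  cases j <;> simp [digitTape]

theorem digitTape_append (p : List Bool) (b : Bool) (l : List Bool) :
    digitTape (p ++ b :: l) (p.length + 1) = some (some b) := by
  simp [digitTape]

theorem digitTape_length (p : List Bool) : digitTape p (p.length + 1) = none := by
  simp [digitTape]

theorem update_digitTape_append (p : List Bool) (b c : Bool) (l : List Bool) :
    Function.update (digitTape (p ++ b :: l)) (p.length + 1) (some (some c)) =
      digitTape (p ++ c :: l) := by
  funext j
  rcases j with _ | j
  · simp [digitTape]
  · rcases lt_trichotomy j p.length with h | rfl | h
    · simp [digitTape, h, h.ne, List.getElem?_append_left]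
    · simp [digitTape]
    · obtain ⟨k, rfl⟩ := Nat.exists_eq_add_of_lt h
      simp [digitTape, List.getElem?_append_right, Nat.add_assoc]

theorem update_digitTape_length (p : List Bool) (c : Bool) :
    Function.update (digitTape p) (p.length + 1) (some (some c)) = digitTape (p ++ [c]) := by
  funext j
  rcases j with _ | j
  · simp [digitTape]
  · rcases lt_trichotomy j p.length with h | rfl | h
    · simp [digitTape, h, h.ne, List.getElem?_append_left]
    · simp [digitTape]
    · simp [digitTape, h.ne', List.getElem?_eq_none, h.le, Nat.succ_le_of_lt h]

theorem update_digitTape_concat (p : List Bool) (c : Bool) :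
    Function.update (digitTape (p ++ [c])) (p.length + 1) none = digitTape p := by
  rw [← update_digitTape_length, Function.update_idem, Function.update_eq_self_iff,
    digitTape_length]

/-- The contents of the registers and the position of the input head. -/
@[ext]
structure Memory where
  reg : ℕ → ℕ
  pos : ℕ

namespace Memory

/-- Overwrite a register. -/
def set (S : Memory) (i x : ℕ) : Memory := ⟨Function.update S.reg i x, S.pos⟩

/-- Tape `i` has its head at cell `h` and the contents `τ`; every other tape `k` holds register
`k`, with its head at the end marker. -/
def focus {K : ℕ} (S : Memory) (i : Fin K) (h : ℕ) (τ : ℕ → WorkLetter) : Store K where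
  inputHead := S.pos
  head := Function.update (fun _ => 0) i h
  tape := Function.update (fun k => digitTape (S.reg k).bits) i τ

/-- Every tape `k` holds register `k`, and the heads on the tapes in `I` are at cell `h`, the
others at the end marker. -/
def withHeads {K : ℕ} (S : Memory) (I : Finset (Fin K)) (h : ℕ) : Store K where
  inputHead := S.pos
  head := fun k => if k ∈ I then h else 0
  tape := fun k => digitTape (S.reg k).bits

/-- Every tape `k` holds register `k`, with its head at the end marker. -/
def store (K : ℕ) (S : Memory) : Store K where
  inputHead := S.pos
  head := fun _ => 0
  tape := fun k => digitTape (S.reg k).bits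

variable {K : ℕ} {S : Memory} {i : Fin K} {h s : ℕ} {τ : ℕ → WorkLetter}

/-- The link between work on a single tape and an assignment to a register. -/
theorem focus_zero (x : ℕ) : S.focus i 0 (digitTape x.bits) = (S.set i x).store K := by
  ext k j
  · rfl
  · simp [focus, store]
  · by_cases hk : k = i
    · subst hk; simp [focus, store, set]
    · have : (k : ℕ) ≠ i := fun h => hk (Fin.ext h)
      simp [focus, store, set, hk, this]

theorem set_self : S.set i (S.reg i) = S := by
  simp [set]

theorem store_eq_focus (i : Fin K) : S.store K = S.focus i 0 (digitTape (S.reg i).bits) := by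
  rw [focus_zero, set_self]

theorem store_eq_withHeads (I : Finset (Fin K)) : S.store K = S.withHeads I 0 := by
  simp [store, withHeads]

theorem within_focus (h0 : h < s) : (S.focus i h τ).Within s := by
  intro k
  by_cases hk : k = i
  · subst hk; simpa [focus]
  · simp only [focus, ne_eq, hk, not_false_eq_true, Function.update_of_ne]
    omega

theorem within_withHeads {I : Finset (Fin K)} (h0 : h < s) : (S.withHeads I h).Within s := by
  intro k
  simp only [withHeads]
  split_ifs <;> omega

theorem within_store (h0 : 0 < s) : (S.store K).Within s := fun _ => h0

theorem scan_focus : (S.focus i h τ).scan i = τ h := by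
  simp [focus, Store.scan]

end Memory

/-- Act on tape `i` only, on which `r` is done. -/
def actOn {K : ℕ} (i : Fin K) (t : Fin K → WorkLetter) (r : WorkLetter × HeadMove) : TapeAction K :=
  (.stay, Function.update (fun k => (t k, .stay)) i r)

/-- Move the heads on the tapes in `I`, and change no tape. -/
def moveOn {K : ℕ} (I : Finset (Fin K)) (t : Fin K → WorkLetter) (m : HeadMove) : TapeAction K :=
  (.stay, fun k => (t k, if k ∈ I then m else .stay))

/-- Move the input head only. -/
def moveInputOnly {K : ℕ} (t : Fin K → WorkLetter) (m : HeadMove) : TapeAction K :=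
  (m, fun k => (t k, .stay))

namespace Memory

variable {K : ℕ} {S : Memory} {i : Fin K} {h s : ℕ} {τ : ℕ → WorkLetter} {w : List Bool}

theorem act_focus (x : WorkLetter) (m : HeadMove) :
    (S.focus i h τ).act w (actOn i (S.focus i h τ).scan (x, m)) =
      S.focus i (OfflineTM.moveWork h m) (Function.update τ h x) := by
  ext k j
  · rfl
  · by_cases hk : k = i
    · subst hk; simp [focus, Store.act, actOn]
    · simp [focus, Store.act, actOn, hk, OfflineTM.moveWork]
  · by_cases hk : k = i
    · subst hk; simp [focus, Store.act, actOn]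
    · simp [focus, Store.act, actOn, hk, Store.scan]

theorem act_focus_move (m : HeadMove) :
    (S.focus i h τ).act w (actOn i (S.focus i h τ).scan ((S.focus i h τ).scan i, m)) =
      S.focus i (OfflineTM.moveWork h m) τ := by
  rw [act_focus, scan_focus, Function.update_eq_self]

theorem act_withHeads (I : Finset (Fin K)) (m : HeadMove) :
    (S.withHeads I h).act w (moveOn I (S.withHeads I h).scan m) =
      S.withHeads I (OfflineTM.moveWork h m) := by
  ext k j
  · rfl
  · by_cases hk : k ∈ I <;> simp [withHeads, Store.act, moveOn, hk, OfflineTM.moveWork]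
  · simp [withHeads, Store.act, moveOn, Store.scan]

theorem act_store (m : HeadMove) :
    (S.store K).act w (moveInputOnly (S.store K).scan m) =
      (Memory.mk S.reg (OfflineTM.moveInput w S.pos m)).store K := by
  ext k j
  · rfl
  · rfl
  · simp [store, Store.act, moveInputOnly, Store.scan]

end Memory

/-! ### Elementary routines: increment, clear, compare, and reading the input -/

namespace Routine

variable {K : ℕ} {w : List Bool} {s : ℕ} {S : Memory}

/-- Increment register `i`. -/
def incr (i : Fin K) : Routine K where
  State := Fin 3
  finState := inferInstance
  start := 0
  trans
    | 0, _, t => (.inl 1, actOn i t (t i, .right))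
    | 1, _, t =>
      if t i = some (some true) then (.inl 1, actOn i t (some (some false), .right))
      else (.inl 2, actOn i t (some (some true), .stay))
    | 2, _, t =>
      if t i = some none then (.inr true, actOn i t (t i, .stay))
      else (.inl 2, actOn i t (t i, .left))

theorem runs_incr_back (i : Fin K) (l : List Bool) (h : ℕ) (hs : h < s) :
    (incr i).Runs w s (2 : Fin 3) (S.focus i h (digitTape l)) true (S.focus i 0 (digitTape l)) := by
  induction h with
  | zero =>
    refine .exit_of_eq _ (Memory.within_focus hs) ?_ (Memory.act_focus_move .stay)
    simp [incr, Memory.scan_focus, digitTape_eq_mark_iff]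
  | succ h ih =>
    refine .step_of_eq (2 : Fin 3) _ _ (Memory.within_focus hs) ?_ (Memory.act_focus_move .left)
      (ih (by omega))
    simp [incr, Memory.scan_focus, digitTape_eq_mark_iff]

/-- Here `p` collects the digits already passed and `l` those not yet scanned; the carry turns each
`true` into `false` and stops at the first `false` or blank. -/
theorem runs_incr_carry (i : Fin K) (l p : List Bool) (hs : (p ++ l).length + 1 < s) :
    (incr i).Runs w s (1 : Fin 3) (S.focus i (p.length + 1) (digitTape (p ++ l))) true
      (S.focus i 0 (digitTape (p ++ incrDigits l))) := by
  induction l generalizing p with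
  | nil =>
    rw [List.append_nil] at hs ⊢
    refine .step_of_eq (2 : Fin 3) _ _ (Memory.within_focus hs) ?_
      (Memory.act_focus (some (some true)) .stay) ?_
    · simp [incr, Memory.scan_focus, digitTape_length]
    · rw [update_digitTape_length]
      exact runs_incr_back i _ _ hs
  | cons b l ih =>
    have hs' : p.length + 1 < s := by simp at hs; omega
    cases b
    · refine .step_of_eq (2 : Fin 3) _ _ (Memory.within_focus hs') ?_
        (Memory.act_focus (some (some true)) .stay) ?_
      · simp [incr, Memory.scan_focus, digitTape_append]
      · rw [update_digitTape_append]
        exact runs_incr_back i _ _ hs'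
    · refine .step_of_eq (1 : Fin 3) _ _ (Memory.within_focus hs') ?_
        (Memory.act_focus (some (some false)) .right) ?_
      · simp [incr, Memory.scan_focus, digitTape_append]
      · rw [update_digitTape_append]
        simpa [OfflineTM.moveWork, incrDigits] using ih (p ++ [false]) (by simpa using hs)

theorem runs_incr (i : Fin K) (hs : (S.reg i).bits.length + 1 < s) :
    (incr i).Runs w s (incr i).start (S.store K) true ((S.set i (S.reg i + 1)).store K) := by
  rw [← Memory.focus_zero, Memory.store_eq_focus i, bits_succ]
  refine .step_of_eq (1 : Fin 3) _ _ (Memory.within_focus (by omega)) rfl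
    (Memory.act_focus_move .right) ?_
  simpa [OfflineTM.moveWork] using runs_incr_carry i (S.reg i).bits [] hs

/-- Set register `i` to zero. -/
def clear (i : Fin K) : Routine K where
  State := Fin 3
  finState := inferInstance
  start := 0
  trans
    | 0, _, t => (.inl 1, actOn i t (t i, .right))
    | 1, _, t =>
      if t i = none then (.inl 2, actOn i t (t i, .left))
      else (.inl 1, actOn i t (t i, .right))
    | 2, _, t =>
      if t i = some none then (.inr true, actOn i t (t i, .stay))
      else (.inl 2, actOn i t (none, .left))

/-- The head stands on the last digit. Erasing from the right leaves a digit string, one shorter,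
after each step. -/
theorem runs_clear_back (i : Fin K) (l : List Bool) (hs : l.length < s) :
    (clear i).Runs w s (2 : Fin 3) (S.focus i l.length (digitTape l)) true
      (S.focus i 0 (digitTape [])) := by
  induction l using List.reverseRecOn with
  | nil =>
    refine .exit_of_eq _ (Memory.within_focus hs) ?_ (Memory.act_focus_move .stay)
    simp [clear, Memory.scan_focus, digitTape_eq_mark_iff]
  | append_singleton l b ih =>
    rw [List.length_append, List.length_singleton] at hs ⊢
    refine .step_of_eq (2 : Fin 3) _ _ (Memory.within_focus hs) ?_
      (Memory.act_focus none .left) ?_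
    · simp [clear, Memory.scan_focus, digitTape_eq_mark_iff]
    · rw [update_digitTape_concat]
      exact ih (by omega)

theorem runs_clear_forth (i : Fin K) (l p : List Bool) (hs : (p ++ l).length + 1 < s) :
    (clear i).Runs w s (1 : Fin 3) (S.focus i (p.length + 1) (digitTape (p ++ l))) true
      (S.focus i 0 (digitTape [])) := by
  induction l generalizing p with
  | nil =>
    rw [List.append_nil] at hs ⊢
    refine .step_of_eq (2 : Fin 3) _ _ (Memory.within_focus hs) ?_
      (Memory.act_focus_move .left) (runs_clear_back i p (by omega))
    simp [clear, Memory.scan_focus, digitTape_length]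
  | cons b l ih =>
    refine .step_of_eq (1 : Fin 3) _ _ (Memory.within_focus (by simp at hs; omega)) ?_
      (Memory.act_focus_move .right) ?_
    · simp [clear, Memory.scan_focus, digitTape_append]
    · simpa [OfflineTM.moveWork] using ih (p ++ [b]) (by simpa using hs)

theorem runs_clear (i : Fin K) (hs : (S.reg i).bits.length + 1 < s) :
    (clear i).Runs w s (clear i).start (S.store K) true ((S.set i 0).store K) := by
  rw [← Memory.focus_zero, Memory.store_eq_focus i, Nat.zero_bits]
  refine .step_of_eq (1 : Fin 3) _ _ (Memory.within_focus (by omega)) rfl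
    (Memory.act_focus_move .right) ?_
  simpa [OfflineTM.moveWork] using runs_clear_forth i (S.reg i).bits [] hs

/-- Leave by the exit `true` if the registers `i` and `j` agree, and by `false` otherwise. -/
def equal (i j : Fin K) : Routine K where
  State := Option Bool ⊕ Unit
  finState := inferInstance
  start := .inr ()
  trans
    | .inr _, _, t => (.inl (.inl none), moveOn {i, j} t .right)
    | .inl none, _, t =>
      if t i = t j then
        if t i = none then (.inl (.inl (some true)), moveOn {i, j} t .stay)
        else (.inl (.inl none), moveOn {i, j} t .right)
      else (.inl (.inl (some false)), moveOn {i, j} t .stay)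
    | .inl (some b), _, t =>
      if t i = some none then (.inr b, moveOn {i, j} t .stay)
      else (.inl (.inl (some b)), moveOn {i, j} t .left)

theorem runs_equal_back (i j : Fin K) (b : Bool) (h : ℕ) (hs : h < s) :
    (equal i j).Runs w s (Sum.inl (some b) : Option Bool ⊕ Unit) (S.withHeads {i, j} h) b
      (S.withHeads {i, j} 0) := by
  induction h with
  | zero =>
    refine .exit_of_eq _ (Memory.within_withHeads hs) ?_ (Memory.act_withHeads {i, j} .stay)
    simp [equal, Memory.withHeads, Store.scan, digitTape_eq_mark_iff]
  | succ h ih =>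
    refine .step_of_eq (Sum.inl (some b) : Option Bool ⊕ Unit) _ _ (Memory.within_withHeads hs) ?_
      (Memory.act_withHeads {i, j} .left) (ih (by omega))
    simp [equal, Memory.withHeads, Store.scan, digitTape_eq_mark_iff]

theorem scan_withHeads {i : Fin K} {I : Finset (Fin K)} (hI : i ∈ I) (p l : List Bool)
    (hi : (S.reg i).bits = p ++ l) :
    (S.withHeads I (p.length + 1)).scan i = l.head?.map some := by
  simp [Memory.withHeads, Store.scan, hi, hI, digitTape, List.head?_eq_getElem?,
    List.getElem?_append_right]

theorem runs_equal_mismatch (i j : Fin K) (p l m : List Bool) (hi : (S.reg i).bits = p ++ l)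
    (hj : (S.reg j).bits = p ++ m) (hs : p.length + 1 < s) (hne : l.head? ≠ m.head?) :
    (equal i j).Runs w s (Sum.inl none : Option Bool ⊕ Unit) (S.withHeads {i, j} (p.length + 1))
      (decide (l = m)) (S.withHeads {i, j} 0) := by
  have hlm : l ≠ m := fun h => hne (h ▸ rfl)
  refine .step_of_eq (Sum.inl (some false) : Option Bool ⊕ Unit) _ _ (Memory.within_withHeads hs)
    ?_ (Memory.act_withHeads {i, j} .stay) ?_
  · have : Option.map some l.head? ≠ Option.map some m.head? := fun h =>
      hne (Option.map_injective (Option.some_injective _) h)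
    simp only [equal, scan_withHeads (Finset.mem_insert_self i {j}) p l hi,
      scan_withHeads (Finset.mem_insert_of_mem (Finset.mem_singleton_self j)) p m hj, this, if_false]
  · rw [decide_eq_false hlm]
    exact runs_equal_back i j false _ hs

/-- The heads move in parallel past the common prefix `p` and stop at the first mismatch, at the
latest at the first blank of tape `i`. This is why only the length of register `i` enters the space
bound. -/
theorem runs_equal_forth (i j : Fin K) (p l m : List Bool) (hi : (S.reg i).bits = p ++ l)
    (hj : (S.reg j).bits = p ++ m) (hs : (p ++ l).length + 1 < s) :
    (equal i j).Runs w s (Sum.inl none : Option Bool ⊕ Unit) (S.withHeads {i, j} (p.length + 1))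
      (decide (l = m)) (S.withHeads {i, j} 0) := by
  induction l generalizing p m with
  | nil =>
    have hs' : p.length + 1 < s := by simpa using hs
    cases m with
    | nil =>
      refine .step_of_eq (Sum.inl (some true) : Option Bool ⊕ Unit) _ _
        (Memory.within_withHeads hs') ?_ (Memory.act_withHeads {i, j} .stay)
        (runs_equal_back i j true _ hs')
      simp [equal, scan_withHeads (Finset.mem_insert_self i {j}) p [] hi,
        scan_withHeads (Finset.mem_insert_of_mem (Finset.mem_singleton_self j)) p [] hj]
    | cons c m => exact runs_equal_mismatch i j p [] (c :: m) hi hj hs' (by simp)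
  | cons b l ih =>
    have hs' : p.length + 1 < s := by simp at hs; omega
    by_cases hbm : (b :: l).head? = m.head?
    · obtain ⟨m, rfl⟩ : ∃ m', m = b :: m' := List.head?_eq_some_iff.1 hbm.symm
      refine .step_of_eq (Sum.inl none : Option Bool ⊕ Unit) _ _
        (Memory.within_withHeads hs') ?_ (Memory.act_withHeads {i, j} .right) ?_
      · simp [equal, scan_withHeads (Finset.mem_insert_self i {j}) p (b :: l) hi,
          scan_withHeads (Finset.mem_insert_of_mem (Finset.mem_singleton_self j)) p (b :: m) hj]
      · simpa [OfflineTM.moveWork] using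
          ih (p ++ [b]) m (by simpa using hi) (by simpa using hj) (by simpa using hs)
    · exact runs_equal_mismatch i j p (b :: l) m hi hj hs' hbm

theorem runs_equal (i j : Fin K) (hs : (S.reg i).bits.length + 1 < s) :
    (equal i j).Runs w s (equal i j).start (S.store K) (decide (S.reg i = S.reg j))
      (S.store K) := by
  rw [Memory.store_eq_withHeads {i, j}]
  refine .step_of_eq (Sum.inl none : Option Bool ⊕ Unit) _ _
    (Memory.within_withHeads (by omega)) rfl (Memory.act_withHeads {i, j} .right) ?_
  have h := runs_equal_forth (w := w) i j [] (S.reg i).bits (S.reg j).bits rfl rfl hs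
  have hinj : (S.reg i).bits = (S.reg j).bits ↔ S.reg i = S.reg j := bits_injective.eq_iff
  simpa [OfflineTM.moveWork, hinj] using h

/-- Move the input head to the left end of the input. -/
def rewind : Routine K where
  State := Unit
  finState := inferInstance
  start := ()
  trans
    | _, .leftEnd, t => (.inr true, moveInputOnly t .stay)
    | _, _, t => (.inl (), moveInputOnly t .left)

theorem runs_rewind (hs : 0 < s) :
    (rewind (K := K)).Runs w s rewind.start (S.store K) true
      ((Memory.mk S.reg 0).store K) := by
  obtain ⟨reg, p⟩ := S
  induction p with
  | zero =>
    exact .exit_of_eq _ (Memory.within_store hs) rfl (Memory.act_store .stay)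
  | succ p ih =>
    refine .step_of_eq () _ _ (Memory.within_store hs) ?_ (Memory.act_store .left) ih
    change rewind.trans () (OfflineTM.inputCell w (p + 1)) _ = _
    rw [OfflineTM.inputCell]
    cases w[p]? <;> rfl

/-- Move the input head one cell to the right. -/
def advance : Routine K := single fun _ t => (true, moveInputOnly t .right)

theorem runs_advance (hs : 0 < s) :
    (advance (K := K)).Runs w s advance.start (S.store K) true
      ((Memory.mk S.reg (min (S.pos + 1) (w.length + 1))).store K) := by
  have := runs_single (w := w) (f := fun _ t => (true, moveInputOnly t .right))
    (Memory.within_store (S := S) (K := K) hs) rfl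
  rwa [Memory.act_store] at this

/-- Test whether the scanned input letter is `b`. -/
def letterIs (b : Bool) : Routine K := single fun c t =>
  (match c with
    | .letter a => a == b
    | _ => false, moveInputOnly t .stay)

/-- Cell `0` is the left end marker, so letter `x` is in cell `x + 1`. The head cannot pass the
right end marker, whence the minimum; there the test fails, in accordance with `w[x]? = none`. -/
theorem runs_letterIs (hs : 0 < s) (b : Bool) {x : ℕ}
    (hx : S.pos = min (x + 1) (w.length + 1)) :
    (letterIs (K := K) b).Runs w s (letterIs b).start (S.store K) (decide (w[x]? = some b))
      (S.store K) := by
  have hcell : OfflineTM.inputCell w S.pos = OfflineTM.inputCell w (x + 1) := by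
    rw [hx]
    rcases le_total x w.length with h | h
    · rw [min_eq_left (by omega)]
    · rw [min_eq_right (by omega)]
      simp [OfflineTM.inputCell, h]
  refine .exit_of_eq _ (Memory.within_store hs) ?_ (Memory.act_store .stay)
  change (single _).trans () (OfflineTM.inputCell w S.pos) _ = _
  rw [hcell, OfflineTM.inputCell]
  cases hw : w[x]? with
  | none => simp [single]; rfl
  | some a => cases a <;> cases b <;> simp [single] <;> rfl

/-- Take one idle step and leave by the exit `b`. -/
def leave (b : Bool) : Routine K := single fun _ t => (b, moveInputOnly t .stay)

theorem runs_leave (hs : 0 < s) (b : Bool) :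
    (leave (K := K) b).Runs w s (leave b).start (S.store K) b (S.store K) := by
  have := runs_single (w := w) (f := fun _ t => (b, moveInputOnly t .stay))
    (Memory.within_store (S := S) (K := K) hs) rfl
  rwa [Memory.act_store] at this

/-- Write the end markers. -/
def setup : Routine K := single fun _ _ => (true, .stay, fun _ => (some none, .stay))

/-- Zero is the empty digit string, so on blank tapes the markers alone set every register to zero.
-/
theorem runs_setup (hs : 0 < s) :
    (setup (K := K)).Runs w s setup.start ⟨0, fun _ => 0, fun _ _ => none⟩ true
      ((Memory.mk (fun _ => 0) 0).store K) := by
  refine .exit_of_eq _ (fun _ => hs) rfl ?_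
  ext k j
  · rfl
  · rfl
  · cases j <;> simp [Store.act, Memory.store, digitTape]

end Routine

/-! ### Register programs in logarithmic space -/

/-- The bound on the contents of registers during a computation on the input `w`. -/
def regBound (w : List Bool) : ℕ := (w.length + 2) ^ 2

/-- The number of work cells used by register programs on the input `w`. -/
def workspace (w : List Bool) : ℕ := (regBound w).bits.length + 2

/-- With `L = Nat.log 2 w.length`, one has `|w| + 2 < 2 ^ (L + 3)`, so `regBound w` has at most `2L
+ 6` binary digits, and `2L + 8 ≤ 8(L + 1)`. -/
theorem workspace_le (w : List Bool) : workspace w ≤ 8 * (Nat.log 2 w.length + 1) := by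
  have h1 : w.length < 2 ^ (Nat.log 2 w.length + 1) := Nat.lt_pow_succ_log_self (by norm_num) _
  have h2 : w.length + 2 ≤ 2 ^ (Nat.log 2 w.length + 3) - 1 := by
    have : 2 ^ (Nat.log 2 w.length + 3) = 4 * 2 ^ (Nat.log 2 w.length + 1) := by ring
    have : 2 ≤ 2 ^ (Nat.log 2 w.length + 1) := by
      rw [pow_succ]
      have := Nat.one_le_two_pow (n := Nat.log 2 w.length)
      omega
    omega
  have h3 : regBound w < 2 ^ (2 * (Nat.log 2 w.length + 3)) := by
    rw [regBound, mul_comm, pow_mul]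
    exact Nat.pow_lt_pow_left (by omega) (by norm_num)
  rw [workspace, Nat.size_eq_bits_len]
  have := Nat.size_le.2 h3
  omega

/-- Cell `x.bits.length + 1`, the first blank, is the farthest one needed by `incr`, `clear` and
`equal`. -/
theorem lt_workspace {w : List Bool} {x : ℕ} (h : x ≤ regBound w) :
    x.bits.length + 1 < workspace w := by
  have := length_bits_mono h
  rw [workspace]
  omega

theorem workspace_pos (w : List Bool) : 0 < workspace w := by
  rw [workspace]
  omega

theorem length_le_regBound (w : List Bool) : w.length ≤ regBound w := by
  rw [regBound]
  nlinarith

namespace Memory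

/-- The registers below `K` do not exceed the bound. -/
def Fits (K : ℕ) (w : List Bool) (S : Memory) : Prop := ∀ i < K, S.reg i ≤ regBound w

/-- The registers below `l` agree. -/
def Agree (l : ℕ) (S S' : Memory) : Prop := ∀ i < l, S.reg i = S'.reg i

variable {K l : ℕ} {w : List Bool} {S S' S'' : Memory}

theorem Fits.set (h : S.Fits K w) (i : ℕ) {x : ℕ} (hx : x ≤ regBound w) :
    (S.set i x).Fits K w := by
  intro j hj
  by_cases hij : j = i
  · subst hij
    simpa [Memory.set]
  · simpa [Memory.set, hij] using h j hj

theorem Agree.refl : S.Agree l S := fun _ _ => rfl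

theorem Agree.trans (h : S.Agree l S') (h' : S'.Agree l S'') : S.Agree l S'' := fun i hi =>
  (h i hi).trans (h' i hi)

theorem Agree.mono {l' : ℕ} (h : S.Agree l S') (hl : l' ≤ l) : S.Agree l' S' := fun i hi =>
  h i (by omega)

theorem Agree.set (h : S.Agree l S') {i : ℕ} (hi : l ≤ i) (x : ℕ) : (S.set i x).Agree l S' := by
  intro j hj
  have : j ≠ i := by omega
  simpa [Memory.set, this] using h j hj

@[simp]
theorem reg_set_self (i x : ℕ) : (S.set i x).reg i = x := by
  simp [Memory.set]

theorem reg_set_of_ne {i j : ℕ} (h : j ≠ i) (x : ℕ) : (S.set i x).reg j = S.reg j := by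
  simp [Memory.set, h]

@[simp]
theorem pos_set (i x : ℕ) : (S.set i x).pos = S.pos := rfl

end Memory

/-! ### Total correctness rules for routines, loops and register arithmetic -/

namespace Routine

variable {K : ℕ} {w : List Bool} {S : Memory} {Q : Bool → Memory → Prop}

/-- Started with the memory `S`, the routine `R` terminates within the work space, and its exit and
the resulting memory satisfy `Q`. -/
def Yields (R : Routine K) (w : List Bool) (S : Memory) (Q : Bool → Memory → Prop) : Prop :=
  ∃ b S', R.Runs w (workspace w) R.start (S.store K) b (S'.store K) ∧ Q b S'

theorem Yields.mono {R : Routine K} {Q' : Bool → Memory → Prop} (h : R.Yields w S Q)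
    (hQ : ∀ b S', Q b S' → Q' b S') : R.Yields w S Q' := by
  obtain ⟨b, S', hr, hq⟩ := h
  exact ⟨b, S', hr, hQ b S' hq⟩

theorem yields_branch {R A B : Routine K}
    (h : R.Yields w S fun b S' => (bif b then A else B).Yields w S' Q) :
    (branch R A B).Yields w S Q := by
  obtain ⟨b, S₁, hr, b', S', hr', hq⟩ := h
  exact ⟨b', S', hr.branch hr', hq⟩

/-- Run `A`, then `B`. -/
def seq (A B : Routine K) : Routine K := branch A B B

theorem yields_seq {A B : Routine K} (h : A.Yields w S fun _ S' => B.Yields w S' Q) :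
    (A.seq B).Yields w S Q :=
  yields_branch (h.mono fun b _ h' => by cases b <;> exact h')

/-- A loop rule that includes termination: `I` is the invariant, and its first argument is a variant
that decreases in every round. -/
theorem yields_repeatUntil {C A : Routine K} (I : ℕ → Memory → Prop)
    (h : ∀ m S, I m S → C.Yields w S fun b S' =>
      if b then Q true S' else A.Yields w S' fun _ S'' => ∃ m' < m, I m' S'')
    {m : ℕ} (hm : I m S) : (C.repeatUntil A).Yields w S Q := by
  induction m using Nat.strong_induction_on generalizing S with
  | _ m ih =>
    obtain ⟨b, S₁, hr, hq⟩ := h m S hm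
    cases b
    · obtain ⟨b, S₂, hr', m', hm', hI⟩ := hq
      obtain ⟨b', S₃, hr'', hq'⟩ := ih m' hm' hI
      -- The induction hypothesis leaves the exit unspecified, but a loop has no exit `false`.
      have hb : ∀ {q d b d'}, (C.repeatUntil A).Runs w (workspace w) q d b d' → b = true := by
        intro q d b d' hrun
        induction hrun with
        | @exit q d b a hs h =>
          rcases q with q | q
          · simp only [repeatUntil] at h
            rcases hx : (C.trans q (OfflineTM.inputCell w d.inputHead) d.scan).1 with x | x
            · simp [hx] at h
            · cases x <;> simp_all
          · simp only [repeatUntil] at h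
            rcases hx : (A.trans q (OfflineTM.inputCell w d.inputHead) d.scan).1 with x | x <;>
              simp [hx] at h
        | step _ _ _ ih => exact ih
      obtain rfl := hb hr''
      exact ⟨true, S₃, hr.repeatUntil_continue (hr'.repeatUntil_body hr''), hq'⟩
    · exact ⟨true, S₁, hr.repeatUntil_exit, hq⟩

theorem yields_incr (i : Fin K) (hi : S.reg i ≤ regBound w) (h : Q true (S.set i (S.reg i + 1))) :
    (incr i).Yields w S Q :=
  ⟨_, _, runs_incr i (lt_workspace hi), h⟩

theorem yields_clear (i : Fin K) (hi : S.reg i ≤ regBound w) (h : Q true (S.set i 0)) :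
    (clear i).Yields w S Q :=
  ⟨_, _, runs_clear i (lt_workspace hi), h⟩

theorem yields_equal (i j : Fin K) (hi : S.reg i ≤ regBound w)
    (h : Q (decide (S.reg i = S.reg j)) S) : (equal i j).Yields w S Q :=
  ⟨_, _, runs_equal i j (lt_workspace hi), h⟩

theorem yields_rewind (h : Q true ⟨S.reg, 0⟩) : (rewind (K := K)).Yields w S Q :=
  ⟨_, _, runs_rewind (workspace_pos w), h⟩

theorem yields_advance (h : Q true ⟨S.reg, min (S.pos + 1) (w.length + 1)⟩) :
    (advance (K := K)).Yields w S Q :=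
  ⟨_, _, runs_advance (workspace_pos w), h⟩

theorem yields_letterIs (b : Bool) {x : ℕ} (hx : S.pos = min (x + 1) (w.length + 1))
    (h : Q (decide (w[x]? = some b)) S) : (letterIs (K := K) b).Yields w S Q :=
  ⟨_, _, runs_letterIs (workspace_pos w) b hx, h⟩

theorem yields_leave (b : Bool) (h : Q b S) : (leave (K := K) b).Yields w S Q :=
  ⟨_, _, runs_leave (workspace_pos w) b, h⟩

/-- Run `body` for the values of register `x` from `0` up to, and excluding, register `y`. -/
def forLoop (x y : Fin K) (body : Routine K) : Routine K :=
  (clear x).seq ((equal x y).repeatUntil (body.seq (incr x)))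

/-- The invariant fixes the contents of `x` and `y`, so the equality test decides whether `k = n`;
the variant is `n - k`. -/
theorem yields_forLoop {x y : Fin K} {body : Routine K} (hS : S.Fits K w) {n : ℕ}
    (I : ℕ → Memory → Prop) (h0 : I 0 (S.set x 0))
    (hI : ∀ k S, I k S → S.Fits K w ∧ S.reg x = k ∧ S.reg y = n)
    (hbody : ∀ k < n, ∀ S, I k S → body.Yields w S fun _ S' =>
      S'.Fits K w ∧ S'.reg x = k ∧ I (k + 1) (S'.set x (k + 1))) :
    (forLoop x y body).Yields w S fun _ S' => I n S' := by
  refine yields_seq (yields_clear x (hS x x.2) ?_)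
  refine yields_repeatUntil (fun m S => ∃ k, k + m = n ∧ I k S) ?_ ⟨0, Nat.zero_add n, h0⟩
  rintro m S ⟨k, hkm, hk⟩
  obtain ⟨hfit, hx, hy⟩ := hI k S hk
  refine yields_equal x y (hfit x x.2) ?_
  by_cases hkn : k = n
  · subst hkn
    simpa [hx, hy] using hk
  · have : S.reg x ≠ S.reg y := by rw [hx, hy]; exact hkn
    simp only [this, decide_false, Bool.false_eq_true, if_false]
    refine yields_seq ((hbody k (by omega) S hk).mono ?_)
    rintro _ S' ⟨hfit', hx', hI'⟩
    refine yields_incr x (hfit' x x.2) ⟨m - 1, by omega, k + 1, by omega, ?_⟩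
    rwa [hx']

/-- Add register `y` to register `x`, with the auxiliary register `a`. -/
def addReg (x y a : Fin K) : Routine K := forLoop a y (incr x)

theorem yields_addReg {x y a : Fin K} (hxy : (x : ℕ) ≠ y) (hxa : (x : ℕ) ≠ a) (hya : (y : ℕ) ≠ a)
    (hS : S.Fits K w) (hle : S.reg x + S.reg y ≤ regBound w) :
    (addReg x y a).Yields w S fun _ S' => S'.Fits K w ∧ S'.reg x = S.reg x + S.reg y ∧
      ∀ i, i ≠ (x : ℕ) → i ≠ (a : ℕ) → S'.reg i = S.reg i := by
  have hy := hS y y.2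
  refine (yields_forLoop hS (n := S.reg y) (fun k S' => k ≤ S.reg y ∧ S'.Fits K w ∧ S'.reg a = k ∧
    S'.reg x = S.reg x + k ∧ ∀ i, i ≠ (x : ℕ) → i ≠ (a : ℕ) → S'.reg i = S.reg i) ?_ ?_ ?_).mono ?_
  · refine ⟨Nat.zero_le _, hS.set _ (Nat.zero_le _), by simp, by
      rw [Memory.reg_set_of_ne hxa]; rfl, fun i _ hia => Memory.reg_set_of_ne hia _⟩
  · rintro k S' ⟨-, hfit, ha, -, hrest⟩
    exact ⟨hfit, ha, hrest y hxy.symm hya⟩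
  · rintro k hk S' ⟨-, hfit, ha, hx, hrest⟩
    refine yields_incr x (hfit x x.2) ⟨hfit.set _ (by omega), ?_, hk, (hfit.set _ ?_).set _ ?_,
      by simp, ?_, ?_⟩
    · rw [Memory.reg_set_of_ne hxa.symm, ha]
    · omega
    · omega
    · rw [Memory.reg_set_of_ne hxa, Memory.reg_set_self, hx]
      ring
    · intro i hix hia
      rw [Memory.reg_set_of_ne hia, Memory.reg_set_of_ne hix, hrest i hix hia]
  · rintro _ S' ⟨-, hfit, -, hx, hrest⟩
    exact ⟨hfit, hx, hrest⟩

/-- Add the product of the registers `y` and `z` to register `x`, with auxiliary registers `a` and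
`b`. -/
def addMulReg (x y z a b : Fin K) : Routine K := forLoop b z (addReg x y a)

theorem yields_addMulReg {x y z a b : Fin K} (hxy : (x : ℕ) ≠ y) (hxa : (x : ℕ) ≠ a)
    (hxb : (x : ℕ) ≠ b) (hxz : (x : ℕ) ≠ z) (hya : (y : ℕ) ≠ a) (hyb : (y : ℕ) ≠ b)
    (hza : (z : ℕ) ≠ a) (hzb : (z : ℕ) ≠ b) (hab : (a : ℕ) ≠ b)
    (hS : S.Fits K w) (hle : S.reg x + S.reg y * S.reg z ≤ regBound w) :
    (addMulReg x y z a b).Yields w S fun _ S' => S'.Fits K w ∧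
      S'.reg x = S.reg x + S.reg y * S.reg z ∧
      ∀ i, i ≠ (x : ℕ) → i ≠ (a : ℕ) → i ≠ (b : ℕ) → S'.reg i = S.reg i := by
  have hz := hS z z.2
  refine (yields_forLoop hS (n := S.reg z) (fun k S' => S'.Fits K w ∧ S'.reg b = k ∧
    S'.reg x = S.reg x + S.reg y * k ∧
    ∀ i, i ≠ (x : ℕ) → i ≠ (a : ℕ) → i ≠ (b : ℕ) → S'.reg i = S.reg i) ?_ ?_ ?_).mono ?_
  · refine ⟨hS.set _ (Nat.zero_le _), by simp, by
      rw [Memory.reg_set_of_ne hxb, Nat.mul_zero, Nat.add_zero],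
      fun i _ _ hib => Memory.reg_set_of_ne hib _⟩
  · rintro k S' ⟨hfit, hb, -, hrest⟩
    exact ⟨hfit, hb, hrest z hxz.symm hza hzb⟩
  · rintro k hk S' ⟨hfit, hb, hx, hrest⟩
    have hy := hrest y hxy.symm hya hyb
    have hmul : S.reg y * (k + 1) ≤ S.reg y * S.reg z := Nat.mul_le_mul_left _ hk
    refine (yields_addReg hxy hxa hya hfit ?_).mono ?_
    · rw [hx, hy]
      rw [Nat.mul_succ] at hmul
      omega
    · rintro _ S'' ⟨hfit', hx', hrest'⟩
      refine ⟨hfit', (hrest' b hxb.symm hab.symm).trans hb, hfit'.set _ (by omega), by simp, ?_, ?_⟩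
      · rw [Memory.reg_set_of_ne hxb, hx', hx, hy]
        ring
      · intro i hix hia hib
        rw [Memory.reg_set_of_ne hib, hrest' i hix hia, hrest i hix hia hib]
  · rintro _ S' ⟨hfit, -, hx, hrest⟩
    exact ⟨hfit, hx, hrest⟩

/-- Test whether register `x` is less than register `y`, with the auxiliary register `a`. -/
def less (x y a : Fin K) : Routine K :=
  (clear a).seq (((branch (equal a x) (leave true) (equal a y)).repeatUntil (incr a)).seq
    (branch (equal a y) (leave false) (leave true)))

/-- Register `a` counts up until it meets `x` or `y`, hence stops at their minimum; then `x < y`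
exactly when this is not the value of `y`. -/
theorem yields_less {x y a : Fin K} (hxa : (x : ℕ) ≠ a) (hya : (y : ℕ) ≠ a) (hS : S.Fits K w) :
    (less x y a).Yields w S fun b S' => (b = true ↔ S.reg x < S.reg y) ∧ S'.Fits K w ∧
      ∀ i, i ≠ (a : ℕ) → S'.reg i = S.reg i := by
  have hx := hS x x.2
  refine yields_seq (yields_clear a (hS a a.2) (yields_seq ?_))
  refine yields_repeatUntil (fun m S' => ∃ k, k + m = min (S.reg x) (S.reg y) ∧ S' = S.set a k)
    ?_ ⟨0, Nat.zero_add _, rfl⟩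
  rintro m _ ⟨k, hkm, rfl⟩
  have hk : k ≤ regBound w := by omega
  have hfit : (S.set a k).Fits K w := hS.set _ hk
  have hend (hk' : k = min (S.reg x) (S.reg y)) :
      (branch (equal a y) (leave false) (leave true)).Yields w (S.set a k) fun b S' =>
        (b = true ↔ S.reg x < S.reg y) ∧ S'.Fits K w ∧ ∀ i, i ≠ (a : ℕ) → S'.reg i = S.reg i := by
    refine yields_branch (yields_equal a y (hfit a a.2) ?_)
    rw [Memory.reg_set_self, Memory.reg_set_of_ne hya]
    by_cases hky : k = S.reg y
    · simp only [hky, decide_true]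
      exact yields_leave _ ⟨by simp; omega, hky ▸ hfit, fun i hi => Memory.reg_set_of_ne hi _⟩
    · simp only [hky, decide_false]
      exact yields_leave _ ⟨by simp; omega, hfit, fun i hi => Memory.reg_set_of_ne hi _⟩
  refine yields_branch (yields_equal a x (hfit a a.2) ?_)
  rw [Memory.reg_set_self, Memory.reg_set_of_ne hxa]
  by_cases hkx : k = S.reg x
  · rw [decide_eq_true hkx]
    exact yields_leave _ (by simpa using hend (by omega))
  · rw [decide_eq_false hkx]
    refine yields_equal a y (hfit a a.2) ?_
    rw [Memory.reg_set_self, Memory.reg_set_of_ne hya]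
    by_cases hky : k = S.reg y
    · rw [decide_eq_true hky]
      simpa using hend (by omega)
    · rw [decide_eq_false hky]
      simp only [Bool.false_eq_true, if_false]
      refine yields_incr a (hfit a a.2) ⟨m - 1, by omega, k + 1, by omega, ?_⟩
      simp [Memory.set]

end Routine

/-! ### Predicates decided by register programs -/

/-- The value `t`, which depends only on the registers below `l`, can be computed into register `l`
without changing the registers below `l`. -/
def IsTerm (l : ℕ) (t : (ℕ → ℕ) → ℕ) : Prop :=
  (∀ σ σ' : ℕ → ℕ, (∀ i < l, σ i = σ' i) → t σ = t σ') ∧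
  ∃ k, ∀ K ≥ k, ∃ R : Routine K, ∀ w S, S.Fits K w → t S.reg ≤ regBound w →
    R.Yields w S fun _ S' => S'.Fits K w ∧ S'.Agree l S ∧ S'.reg l = t S.reg

/-- The predicate `P`, which depends only on the registers below `l`, can be tested without changing
the registers below `l`, as long as these do not exceed the length of the input. -/
def IsTest (l : ℕ) (P : List Bool → (ℕ → ℕ) → Prop) : Prop :=
  (∀ w, ∀ σ σ' : ℕ → ℕ, (∀ i < l, σ i = σ' i) → (P w σ ↔ P w σ')) ∧
  ∃ k, ∀ K ≥ k, ∃ R : Routine K, ∀ w S, S.Fits K w → (∀ i < l, S.reg i ≤ w.length) →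
    R.Yields w S fun b S' => (b = true ↔ P w S.reg) ∧ S'.Fits K w ∧ S'.Agree l S

/-! ### Closure of tests under lookups, connectives, bounded quantifiers and counting -/

section Closure

open Routine Memory

variable {l : ℕ}

theorem isTerm_zero : IsTerm l fun _ => 0 := by
  refine ⟨fun _ _ _ => rfl, l + 1, fun K hK => ⟨clear ⟨l, hK⟩, fun w S hS _ => ?_⟩⟩
  exact yields_clear _ (hS l hK)
    ⟨hS.set _ (Nat.zero_le _), Agree.refl.set le_rfl _, reg_set_self _ _⟩

theorem IsTerm.add_one {t : (ℕ → ℕ) → ℕ} (ht : IsTerm l t) : IsTerm l fun σ => t σ + 1 := by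
  obtain ⟨hc, k, hk⟩ := ht
  refine ⟨fun σ σ' h => by beta_reduce; rw [hc σ σ' h], max k (l + 1), fun K hK => ?_⟩
  have hl : l < K := by omega
  obtain ⟨R, hR⟩ := hk K (by omega)
  refine ⟨R.seq (incr ⟨l, hl⟩), fun w S hS hle => yields_seq ((hR w S hS ((Nat.le_add_right _ _).trans hle)).mono ?_)⟩
  rintro _ S' ⟨hfit, hag, hval⟩
  refine yields_incr _ (hfit l hl) ⟨hfit.set _ ?_, hag.set le_rfl _, ?_⟩
  · rw [hval]
    exact hle
  · simp [hval]

theorem IsTerm.add_reg {t : (ℕ → ℕ) → ℕ} (ht : IsTerm l t) {i : ℕ} (hi : i < l) :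
    IsTerm l fun σ => t σ + σ i := by
  obtain ⟨hc, k, hk⟩ := ht
  refine ⟨fun σ σ' h => by beta_reduce; rw [hc σ σ' h, h i hi], max k (l + 2), fun K hK => ?_⟩
  have hl : l + 1 < K := by omega
  obtain ⟨R, hR⟩ := hk K (by omega)
  refine ⟨R.seq (addReg ⟨l, by omega⟩ ⟨i, by omega⟩ ⟨l + 1, hl⟩), fun w S hS hle =>
    yields_seq ((hR w S hS ((Nat.le_add_right _ _).trans hle)).mono ?_)⟩
  rintro _ S' ⟨hfit, hag, hval⟩
  refine (yields_addReg ?_ ?_ ?_ hfit ?_).mono ?_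
  · exact hi.ne'
  · exact (Nat.lt_succ_self l).ne
  · exact (hi.trans (Nat.lt_succ_self l)).ne
  · change S'.reg l + S'.reg i ≤ _
    rw [hval, hag i hi]
    exact hle
  · rintro _ S'' ⟨hfit', hx, hrest⟩
    refine ⟨hfit', fun j hj => ?_, ?_⟩
    · rw [hrest j hj.ne (hj.trans (Nat.lt_succ_self l)).ne, hag j hj]
    · exact hx.trans (by simp [hval, hag i hi])

theorem IsTerm.add_mul {t : (ℕ → ℕ) → ℕ} (ht : IsTerm l t) {i j : ℕ} (hi : i < l) (hj : j < l) :
    IsTerm l fun σ => t σ + σ i * σ j := by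
  obtain ⟨hc, k, hk⟩ := ht
  refine ⟨fun σ σ' h => by beta_reduce; rw [hc σ σ' h, h i hi, h j hj], max k (l + 3), fun K hK => ?_⟩
  have hl : l + 2 < K := by omega
  obtain ⟨R, hR⟩ := hk K (by omega)
  refine ⟨R.seq (addMulReg ⟨l, by omega⟩ ⟨i, by omega⟩ ⟨j, by omega⟩ ⟨l + 1, by omega⟩ ⟨l + 2, hl⟩),
    fun w S hS hle => yields_seq ((hR w S hS ((Nat.le_add_right _ _).trans hle)).mono ?_)⟩
  rintro _ S' ⟨hfit, hag, hval⟩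
  refine (yields_addMulReg ?_ ?_ ?_ ?_ ?_ ?_ ?_ ?_ ?_ hfit ?_).mono ?_
  any_goals simp only; omega
  · change S'.reg l + S'.reg i * S'.reg j ≤ _
    rw [hval, hag i hi, hag j hj]
    exact hle
  · rintro _ S'' ⟨hfit', hx, hrest⟩
    refine ⟨hfit', fun m hm => ?_, ?_⟩
    · rw [hrest m (by simp only; omega) (by simp only; omega) (by simp only; omega), hag m hm]
    · exact hx.trans (by simp [hval, hag i hi, hag j hj])

theorem IsTest.congr {P P' : List Bool → (ℕ → ℕ) → Prop} (h : IsTest l P)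
    (hP : ∀ w σ, P w σ ↔ P' w σ) : IsTest l P' := by
  obtain rfl : P = P' := by
    funext w σ
    exact propext (hP w σ)
  exact h

theorem isTest_eq {i j : ℕ} (hi : i < l) (hj : j < l) : IsTest l fun _ σ => σ i = σ j := by
  refine ⟨fun _ σ σ' h => by beta_reduce; rw [h i hi, h j hj], l, fun K hK =>
    ⟨equal ⟨i, by omega⟩ ⟨j, by omega⟩, fun w S hS _ => ?_⟩⟩
  exact yields_equal _ _ (hS i (by omega)) ⟨by simp, hS, .refl⟩

/-- The address is computed into register `l`, and register `l + 1` counts the head moves. The bound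
`hle` makes the address fit into a register, even if it lies beyond the end of the input. -/
theorem IsTerm.letter {t : (ℕ → ℕ) → ℕ} (ht : IsTerm l t)
    (hle : ∀ (w : List Bool) (σ : ℕ → ℕ), (∀ i < l, σ i ≤ w.length) → t σ ≤ regBound w)
    (b : Bool) : IsTest l fun w σ => w[t σ]? = some b := by
  obtain ⟨hc, k, hk⟩ := ht
  refine ⟨fun w σ σ' h => by beta_reduce; rw [hc σ σ' h], max k (l + 2), fun K hK => ?_⟩
  have hl : l + 1 < K := by omega
  obtain ⟨R, hR⟩ := hk K (by omega)
  refine ⟨R.seq (rewind.seq (advance.seq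
    ((forLoop ⟨l + 1, hl⟩ ⟨l, by omega⟩ advance).seq (letterIs b)))), fun w S hS hreg => ?_⟩
  refine yields_seq ((hR w S hS (hle w _ hreg)).mono ?_)
  rintro _ S' ⟨hfit, hag, hval⟩
  refine yields_seq (yields_rewind (yields_seq (yields_advance (yields_seq ?_))))
  -- The first `advance` passed the left end marker; after `k` rounds the head is on letter `k`, or
  -- at the right end.
  refine (yields_forLoop (S := ⟨S'.reg, min (0 + 1) (w.length + 1)⟩) hfit (n := t S.reg) (fun k S' => S'.Fits K w ∧ S'.reg (l + 1) = k ∧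
    S'.reg l = t S.reg ∧ S'.pos = min (k + 1) (w.length + 1) ∧ S'.Agree l S) ?_ ?_ ?_).mono ?_
  · exact ⟨Fits.set hfit _ (Nat.zero_le _), reg_set_self _ _,
      (reg_set_of_ne (Nat.lt_succ_self l).ne _).trans hval, rfl, Agree.set hag (Nat.le_succ l) _⟩
  · rintro k S₁ ⟨h1, h2, h3, -, -⟩
    exact ⟨h1, h2, h3⟩
  · rintro k hk S₁ ⟨h1, h2, h3, h4, h5⟩
    have := hle w _ hreg
    refine yields_advance ⟨h1, h2, Fits.set h1 _ (by omega), reg_set_self _ _,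
      (reg_set_of_ne (Nat.lt_succ_self l).ne _).trans h3, ?_, Agree.set h5 (Nat.le_succ l) _⟩
    rw [pos_set, h4]
    simp only
    omega
  · rintro _ S₁ ⟨h1, -, -, h4, h5⟩
    exact yields_letterIs b h4 ⟨by simp, h1, h5⟩

theorem IsTest.not {P : List Bool → (ℕ → ℕ) → Prop} (h : IsTest l P) :
    IsTest l fun w σ => ¬ P w σ := by
  obtain ⟨hc, k, hk⟩ := h
  refine ⟨fun w σ σ' h => not_congr (hc w σ σ' h), k, fun K hK => ?_⟩
  obtain ⟨R, hR⟩ := hk K hK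
  refine ⟨branch R (leave false) (leave true), fun w S hS hreg =>
    yields_branch ((hR w S hS hreg).mono ?_)⟩
  rintro b S' ⟨hb, hS', hag⟩
  cases b
  · exact yields_leave _ ⟨by simpa using hb, hS', hag⟩
  · exact yields_leave _ ⟨by simpa using hb, hS', hag⟩

theorem IsTest.and {P P' : List Bool → (ℕ → ℕ) → Prop} (h : IsTest l P) (h' : IsTest l P') :
    IsTest l fun w σ => P w σ ∧ P' w σ := by
  obtain ⟨hc, k, hk⟩ := h
  obtain ⟨hc', k', hk'⟩ := h'
  refine ⟨fun w σ σ' h => and_congr (hc w σ σ' h) (hc' w σ σ' h), max k k', fun K hK => ?_⟩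
  -- Tests are available for all sufficiently large numbers of tapes, so one `K` serves both
  -- routines.
  obtain ⟨R, hR⟩ := hk K (by omega)
  obtain ⟨R', hR'⟩ := hk' K (by omega)
  refine ⟨branch R R' (leave false), fun w S hS hreg =>
    yields_branch ((hR w S hS hreg).mono ?_)⟩
  rintro b S' ⟨hb, hS', hag⟩
  cases b
  · refine yields_leave _ ⟨?_, hS', hag⟩
    have : ¬ P w S.reg := by simpa using hb
    simp [this]
  · refine (hR' w S' hS' fun i hi => (hag i hi).trans_le (hreg i hi)).mono ?_
    rintro b' S'' ⟨hb', hS'', hag'⟩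
    refine ⟨hb'.trans ?_, hS'', hag'.trans hag⟩
    -- The first routine may have changed registers from `l` on, but `P'` does not depend on them.
    rw [hc' w _ _ hag]
    have : P w S.reg := by simpa using hb
    simp [this]

theorem IsTest.or {P P' : List Bool → (ℕ → ℕ) → Prop} (h : IsTest l P) (h' : IsTest l P') :
    IsTest l fun w σ => P w σ ∨ P' w σ :=
  (h.not.and h'.not).not.congr fun w σ => by tauto

theorem IsTest.imp {P P' : List Bool → (ℕ → ℕ) → Prop} (h : IsTest l P) (h' : IsTest l P') :
    IsTest l fun w σ => P w σ → P' w σ :=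
  (h.and h'.not).not.congr fun w σ => by tauto

theorem IsTest.iff {P P' : List Bool → (ℕ → ℕ) → Prop} (h : IsTest l P) (h' : IsTest l P') :
    IsTest l fun w σ => P w σ ↔ P' w σ :=
  ((h.imp h').and (h'.imp h)).congr fun w σ => by tauto

theorem update_agree {σ σ' : ℕ → ℕ} (h : ∀ i < l, σ i = σ' i) (x : ℕ) :
    ∀ i < l + 1, Function.update σ l x i = Function.update σ' l x i := by
  intro i hi
  by_cases hil : i = l
  · simp [hil]
  · simpa [hil] using h i (by omega)

/-- Quantification over the numbers less than register `0`. -/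
theorem IsTest.ball {P : List Bool → (ℕ → ℕ) → Prop} (hl : 0 < l) (h : IsTest (l + 1) P) :
    IsTest l fun w σ => ∀ x < σ 0, P w (Function.update σ l x) := by
  obtain ⟨hc, k, hk⟩ := h
  refine ⟨fun w σ σ' h => ?_, max k (l + 1), fun K hK => ?_⟩
  · beta_reduce
    rw [h 0 hl]
    exact forall₂_congr fun x _ => hc w _ _ (update_agree h x)
  have hlK : l < K := by omega
  obtain ⟨R, hR⟩ := hk K (by omega)
  let x : Fin K := ⟨l, hlK⟩
  let n : Fin K := ⟨0, by omega⟩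
  -- The search stops when `x` reaches `n` or when `P` fails; the final comparison tells the two
  -- cases apart.
  refine ⟨(clear x).seq (((branch (equal x n) (leave true)
    (branch R (leave false) (leave true))).repeatUntil (incr x)).seq (equal x n)),
    fun w S hS hreg => yields_seq (yields_clear x (hS l hlK) (yields_seq ?_))⟩
  have hn := hreg 0 hl
  have hbound := length_le_regBound w
  refine yields_repeatUntil (fun m S' => ∃ y, y + m = S.reg 0 ∧ S'.Fits K w ∧ S'.Agree l S ∧
    S'.reg l = y ∧ ∀ z < y, P w (Function.update S.reg l z)) ?_
    ⟨0, Nat.zero_add _, hS.set _ (Nat.zero_le _), Agree.refl.set le_rfl _, reg_set_self _ _,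
      fun z hz => absurd hz (Nat.not_lt_zero z)⟩
  rintro m S₁ ⟨y, hym, hfit, hag, hy, hz⟩
  have h0 : S₁.reg n = S.reg 0 := hag 0 hl
  have hx : S₁.reg x = y := hy
  refine yields_branch (yields_equal x n (hfit l hlK) ?_)
  rw [hx, h0]
  by_cases hyn : y = S.reg 0
  · rw [decide_eq_true hyn]
    refine yields_leave _ ?_
    simp only [if_true]
    refine yields_equal x n (hfit l hlK) ⟨?_, hfit, hag⟩
    subst hyn
    simpa [hx, h0] using hz
  · rw [decide_eq_false hyn]
    have hP : P w S₁.reg ↔ P w (Function.update S.reg l y) := by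
      refine hc w _ _ fun i hi => ?_
      by_cases hil : i = l
      · simp [hil, hy]
      · simpa [hil] using hag i (by omega)
    refine yields_branch ((hR w S₁ hfit fun i hi => ?_).mono ?_)
    · by_cases hil : i = l
      · rw [hil, hy]
        omega
      · rw [hag i (by omega)]
        exact hreg i (by omega)
    rintro b S₂ ⟨hb, hfit', hag'⟩
    have hx' : S₂.reg x = y := (hag' l (Nat.lt_succ_self l)).trans hy
    have h0' : S₂.reg n = S.reg 0 := (hag' 0 (Nat.succ_pos l)).trans h0
    have hag'' := (hag'.mono (Nat.le_succ l)).trans hag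
    rw [hP] at hb
    cases b
    · refine yields_leave _ ?_
      simp only [if_true]
      refine yields_equal x n (hfit' l hlK) ⟨?_, hfit', hag''⟩
      -- The search stopped at a counterexample below register `0`, so both sides are false.
      rw [hx', h0', decide_eq_true_iff]
      have hneg : ¬ P w (Function.update S.reg l y) := by simpa using hb
      exact ⟨fun h => absurd h hyn, fun h => absurd (h y (by omega)) hneg⟩
    · refine yields_leave _ ?_
      simp only [Bool.false_eq_true, if_false]
      refine yields_incr x (hfit' l hlK) ⟨m - 1, by omega, y + 1, by omega,
        hfit'.set _ (by omega), hag''.set le_rfl _, by rw [hx']; exact reg_set_self _ _,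
        fun z hz' => ?_⟩
      rcases Nat.lt_succ_iff_lt_or_eq.1 hz' with h | rfl
      · exact hz z h
      · exact hb.1 rfl

theorem IsTest.bex {P : List Bool → (ℕ → ℕ) → Prop} (hl : 0 < l) (h : IsTest (l + 1) P) :
    IsTest l fun w σ => ∃ x < σ 0, P w (Function.update σ l x) :=
  (h.not.ball hl).not.congr fun w σ => by push Not; rfl

/-- The number of `x` less than `m` such that `P` holds when register `i` is `x`. -/
noncomputable def countReg (P : List Bool → (ℕ → ℕ) → Prop) (i : ℕ) (w : List Bool) (σ : ℕ → ℕ)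
    (m : ℕ) : ℕ := {x | x < m ∧ P w (Function.update σ i x)}.ncard

theorem countReg_zero (P : List Bool → (ℕ → ℕ) → Prop) (i : ℕ) (w : List Bool) (σ : ℕ → ℕ) :
    countReg P i w σ 0 = 0 := by
  simp [countReg]

theorem countReg_succ (P : List Bool → (ℕ → ℕ) → Prop) (i : ℕ) (w : List Bool) (σ : ℕ → ℕ)
    (m : ℕ) [Decidable (P w (Function.update σ i m))] : countReg P i w σ (m + 1) =
      countReg P i w σ m + if P w (Function.update σ i m) then 1 else 0 := by
  have hfin : {x | x < m ∧ P w (Function.update σ i x)}.Finite :=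
    (Set.finite_lt_nat m).subset fun x hx => hx.1
  split_ifs with h
  · rw [countReg, countReg, ← Set.ncard_insert_of_notMem (a := m) (fun hm => lt_irrefl m hm.1) hfin]
    congr 1
    ext x
    simp only [Set.mem_ofPred_eq, Set.mem_insert_iff]
    constructor
    · rintro ⟨hx, hp⟩
      exact (Nat.lt_succ_iff_lt_or_eq.1 hx).symm.imp_right fun h => ⟨h, hp⟩
    · rintro (rfl | ⟨hx, hp⟩)
      · exact ⟨Nat.lt_succ_self x, h⟩
      · exact ⟨hx.trans (Nat.lt_succ_self m), hp⟩
  · rw [countReg, countReg, Nat.add_zero]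
    congr 1
    ext x
    simp only [Set.mem_ofPred_eq]
    refine ⟨fun hx => ⟨(Nat.lt_succ_iff_lt_or_eq.1 hx.1).resolve_right ?_, hx.2⟩,
      fun hx => ⟨hx.1.trans (Nat.lt_succ_self m), hx.2⟩⟩
    rintro rfl
    exact h hx.2

theorem countReg_le (P : List Bool → (ℕ → ℕ) → Prop) (i : ℕ) (w : List Bool) (σ : ℕ → ℕ)
    (m : ℕ) : countReg P i w σ m ≤ m := by
  classical
  induction m with
  | zero => exact (countReg_zero P i w σ).le
  | succ m ih =>
    rw [countReg_succ]
    split_ifs <;> omega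

/-- A routine that increments register `c` if `P` holds. -/
theorem yields_incr_if {K : ℕ} {w : List Bool} {S : Memory} {R : Routine K} {p : Prop} [Decidable p]
    {l : ℕ} (c : Fin K) (hc : (c : ℕ) < l)
    (hR : R.Yields w S fun b S' => (b = true ↔ p) ∧ S'.Fits K w ∧ S'.Agree l S)
    (hle : S.reg c < regBound w) :
    (branch R (incr c) (leave true)).Yields w S fun _ S' => S'.Fits K w ∧
      S'.Agree l (S.set c (S.reg c + if p then 1 else 0)) := by
  refine yields_branch (hR.mono ?_)
  rintro b S' ⟨hb, hfit, hag⟩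
  have hval := hag c hc
  have hset : ∀ x, (S'.set c x).Agree l (S.set c x) := by
    intro x i hi
    by_cases hic : i = c
    · simp [hic]
    · rw [reg_set_of_ne hic, reg_set_of_ne hic, hag i hi]
  cases b
  · have hp : ¬ p := by simpa using hb
    refine yields_leave _ ⟨hfit, ?_⟩
    simpa [hp, set_self] using hag
  · have hp : p := by simpa using hb
    refine yields_incr c (hfit c c.2) ⟨hfit.set _ (by omega), ?_⟩
    rw [hval]
    simpa [hp] using hset _

/-- Comparison of the numbers of solutions of two predicates. -/
theorem IsTest.count_lt {P P' : List Bool → (ℕ → ℕ) → Prop} (hl : 0 < l) (h : IsTest (l + 3) P)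
    (h' : IsTest (l + 3) P')
    (hP : ∀ w σ x y, P w (Function.update (Function.update σ l x) (l + 1) y) ↔ P w σ)
    (hP' : ∀ w σ x y, P' w (Function.update (Function.update σ l x) (l + 1) y) ↔ P' w σ) :
    IsTest l fun w σ => countReg P (l + 2) w σ (σ 0) < countReg P' (l + 2) w σ (σ 0) := by
  classical
  -- Apart from the bound variable in register `l + 2`, the predicates depend only on registers
  -- below `l`. Registers `l` and `l + 1` are thus free to hold the two counters.
  have indep : ∀ {P : List Bool → (ℕ → ℕ) → Prop}, IsTest (l + 3) P →
      (∀ w σ x y, P w (Function.update (Function.update σ l x) (l + 1) y) ↔ P w σ) →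
      ∀ w (σ σ' : ℕ → ℕ), (∀ i < l, σ i = σ' i) → σ (l + 2) = σ' (l + 2) →
      (P w σ ↔ P w σ') := by
    intro P h hP w σ σ' hσ hl2
    rw [← hP w σ (σ' l) (σ' (l + 1))]
    refine h.1 w _ _ fun i hi => ?_
    by_cases h1 : i = l + 1
    · simp [h1]
    by_cases h2 : i = l
    · simp [h2]
    by_cases h3 : i = l + 2
    · simp [h3, hl2]
    · simpa [h1, h2] using hσ i (by omega)
  have count_congr : ∀ {P : List Bool → (ℕ → ℕ) → Prop}, IsTest (l + 3) P →
      (∀ w σ x y, P w (Function.update (Function.update σ l x) (l + 1) y) ↔ P w σ) →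
      ∀ w (σ σ' : ℕ → ℕ), (∀ i < l, σ i = σ' i) → ∀ m,
      countReg P (l + 2) w σ m = countReg P (l + 2) w σ' m := by
    intro P h hP w σ σ' hσ m
    refine congrArg Set.ncard (Set.ext fun x => and_congr_right fun _ =>
      indep h hP w _ _ (fun i hi => ?_) ?_)
    · have : i ≠ l + 2 := by omega
      simpa [this] using hσ i hi
    · simp
  have hindep := indep h hP
  have hindep' := indep h' hP'
  refine ⟨fun w σ σ' hσ => ?_, ?_⟩
  · beta_reduce
    rw [hσ 0 hl, count_congr h hP w σ σ' hσ, count_congr h' hP' w σ σ' hσ]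
  obtain ⟨-, k, hk⟩ := h
  obtain ⟨-, k', hk'⟩ := h'
  refine ⟨max (max k k') (l + 4), fun K hK => ?_⟩
  obtain ⟨R, hR⟩ := hk K (by omega)
  obtain ⟨R', hR'⟩ := hk' K (by omega)
  let n : Fin K := ⟨0, by omega⟩
  let c : Fin K := ⟨l, by omega⟩
  let c' : Fin K := ⟨l + 1, by omega⟩
  let x : Fin K := ⟨l + 2, by omega⟩
  refine ⟨(clear c).seq ((clear c').seq ((forLoop x n ((branch R (incr c) (leave true)).seq
    (branch R' (incr c') (leave true)))).seq (less c c' x))), fun w S hS hreg => ?_⟩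
  have hn := hreg 0 hl
  have hbound : w.length < regBound w := by
    rw [regBound]
    nlinarith
  refine yields_seq (yields_clear c (hS c c.2) ?_)
  have hS₁ : (S.set c 0).Fits K w := hS.set _ (Nat.zero_le _)
  refine yields_seq (yields_clear c' (hS₁ c' c'.2) ?_)
  have hS₂ : ((S.set c 0).set c' 0).Fits K w := hS₁.set _ (Nat.zero_le _)
  refine yields_seq ((yields_forLoop hS₂ (n := S.reg 0) (fun y S' => y ≤ S.reg 0 ∧ S'.Fits K w ∧
    S'.reg (l + 2) = y ∧ S'.Agree l S ∧ S'.reg l = countReg P (l + 2) w S.reg y ∧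
    S'.reg (l + 1) = countReg P' (l + 2) w S.reg y) ?_ ?_ ?_).mono ?_)
  · refine ⟨Nat.zero_le _, hS₂.set _ (Nat.zero_le _), reg_set_self _ _,
      ((Agree.refl.set le_rfl _).set (Nat.le_succ l) _).set (by simp [x]) _, ?_, ?_⟩
    · simp [c, c', x, Memory.set, countReg_zero]
    · simp [c, c', x, Memory.set, countReg_zero]
  · rintro y S' ⟨-, h1, h2, h3, -, -⟩
    exact ⟨h1, h2, h3 0 hl⟩
  · rintro y hy S' ⟨-, hfit, hx, hag, hc, hc'⟩
    have hcy := countReg_le P (l + 2) w S.reg y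
    have hcy' := countReg_le P' (l + 2) w S.reg y
    have hle : ∀ i < l + 3, S'.reg i ≤ w.length := by
      intro i hi
      have : i < l ∨ i = l ∨ i = l + 1 ∨ i = l + 2 := by omega
      rcases this with h | rfl | rfl | rfl
      · rw [hag i h]
        exact hreg i h
      · omega
      · omega
      · omega
    have hPS : P w S'.reg ↔ P w (Function.update S.reg (l + 2) y) := by
      refine hindep w _ _ (fun i hi => ?_) (by simp [hx])
      have : i ≠ l + 2 := by omega
      simpa [this] using hag i hi
    refine yields_seq ((yields_incr_if c (show l < l + 3 by omega) ((hR w S' hfit hle)) ?_).mono ?_)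
    · change S'.reg l < _
      omega
    rintro _ S₃ ⟨hfit₃, hag₃⟩
    have e1 : ∀ i < l + 3, i ≠ l → S₃.reg i = S'.reg i := fun i hi hil =>
      (hag₃ i hi).trans (reg_set_of_ne hil _)
    have e2 : S₃.reg l = countReg P (l + 2) w S.reg (y + 1) := by
      rw [hag₃ l (by omega), countReg_succ, ← hc]
      simp [c, hPS]
    have hcs := countReg_le P (l + 2) w S.reg (y + 1)
    have hPS' : P' w S₃.reg ↔ P' w (Function.update S.reg (l + 2) y) := by
      refine hindep' w _ _ (fun i hi => ?_) (by simp [e1, hx])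
      have : i ≠ l + 2 := by omega
      rw [e1 i (by omega) (by omega)]
      simpa [this] using hag i hi
    refine (yields_incr_if c' (show l + 1 < l + 3 by omega) (hR' w S₃ hfit₃ fun i hi => ?_)
      ?_).mono ?_
    · by_cases hil : i = l
      · rw [hil, e2]
        omega
      · rw [e1 i hi hil]
        exact hle i hi
    · change S₃.reg (l + 1) < _
      rw [e1 (l + 1) (by omega) (by omega)]
      omega
    rintro _ S₄ ⟨hfit₄, hag₄⟩
    have e3 : ∀ i < l + 3, i ≠ l + 1 → S₄.reg i = S₃.reg i := fun i hi hil =>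
      (hag₄ i hi).trans (reg_set_of_ne hil _)
    have hx₄ : S₄.reg (l + 2) = y := by
      rw [e3 _ (by omega) (by omega), e1 _ (by omega) (by omega), hx]
    refine ⟨hfit₄, hx₄, hy, hfit₄.set _ (by omega), reg_set_self _ _,
      Agree.set (fun i hi => ?_) (by simp [x]) _, ?_, ?_⟩
    · rw [e3 i (by omega) (by omega), e1 i (by omega) (by omega), hag i hi]
    · rw [reg_set_of_ne (by simp [x]), e3 _ (by omega) (by omega), e2]
    · rw [reg_set_of_ne (by simp [x]), hag₄ _ (by omega), countReg_succ, ← hc',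
        ← e1 (l + 1) (by omega) (by omega)]
      simp [c', hPS']
  · rintro _ S' ⟨-, hfit, hx, hag, hc, hc'⟩
    -- The loop variable is no longer needed and serves as the auxiliary register.
    refine (yields_less (x := c) (y := c') (a := x) ?_ ?_ hfit).mono ?_
    · simp [c, x]
    · simp [c', x]
    · rintro b S'' ⟨hb, hfit', hrest⟩
      refine ⟨hb.trans ?_, hfit', fun i hi => ?_⟩
      · change S'.reg l < S'.reg (l + 1) ↔ _
        rw [hc, hc']
      · rw [hrest i (by simp only [x]; omega), hag i hi]

/-- The number of letters `true` at the beginning of `w`. -/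
def leadingTrue (w : List Bool) : ℕ := (w.takeWhile id).length

theorem leadingTrue_cons_true (w : List Bool) : leadingTrue (true :: w) = leadingTrue w + 1 := by
  simp [leadingTrue]

theorem leadingTrue_cons_false (w : List Bool) : leadingTrue (false :: w) = 0 := by
  simp [leadingTrue]

theorem leadingTrue_le (w : List Bool) : leadingTrue w ≤ w.length :=
  (List.takeWhile_sublist id).length_le

theorem getElem?_of_lt_leadingTrue {w : List Bool} {y : ℕ} (h : y < leadingTrue w) :
    w[y]? = some true := by
  induction w generalizing y with
  | nil => simp [leadingTrue] at h
  | cons b w ih =>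
    cases b
    · simp [leadingTrue_cons_false] at h
    · cases y with
      | zero => rfl
      | succ y => exact ih (by rw [leadingTrue_cons_true] at h; omega)

theorem getElem?_leadingTrue (w : List Bool) : w[leadingTrue w]? ≠ some true := by
  induction w with
  | nil => simp
  | cons b w ih =>
    cases b
    · simp [leadingTrue_cons_false]
    · simpa [leadingTrue_cons_true] using ih

/-- A language is in logarithmic space if it is given by a predicate that can be tested when
register `0` holds the number of letters `true` at the beginning of the input. -/
theorem IsTest.inLogSpace {P : List Bool → (ℕ → ℕ) → Prop} (h : IsTest 1 P) {L : Language Bool}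
    (hL : ∀ w, w ∈ L ↔ P w fun _ => leadingTrue w) : InLogSpace L := by
  obtain ⟨hc, k, hk⟩ := h
  have hend : IsTest 1 fun w σ => ¬ w[0 + σ 0]? = some true :=
    ((isTerm_zero.add_reg Nat.zero_lt_one).letter (fun w σ h =>
      (Nat.zero_add (σ 0)).le.trans ((h 0 Nat.zero_lt_one).trans (length_le_regBound w))) true).not
  obtain ⟨-, k', hk'⟩ := hend
  obtain ⟨K, hK, hK', hK0⟩ : ∃ K, k ≤ K ∧ k' ≤ K ∧ 0 < K := ⟨max (max k k') 1, by omega⟩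
  obtain ⟨R, hR⟩ := hk K hK
  obtain ⟨C, hC⟩ := hk' K hK'
  let n : Fin K := ⟨0, hK0⟩
  -- Register `0` counts up as long as it points to a letter `true`, so it ends at `leadingTrue w`.
  let main : Routine K := (C.repeatUntil (incr n)).seq R
  refine ⟨(setup.seq main).toOfflineTM, 8, fun w => ?_⟩
  have hlead := leadingTrue_le w
  have hbound := length_le_regBound w
  have hmain : main.Yields w ⟨fun _ => 0, 0⟩ fun b _ => b = true ↔ w ∈ L := by
    refine yields_seq (yields_repeatUntil (fun m S => S.Fits K w ∧ S.reg 0 + m = leadingTrue w) ?_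
      ⟨fun _ _ => Nat.zero_le _, Nat.zero_add (leadingTrue w)⟩)
    rintro m S ⟨hfit, hm⟩
    have hle : ∀ i < 1, S.reg i ≤ w.length := by
      intro i hi
      obtain rfl : i = 0 := by omega
      omega
    refine (hC w S hfit hle).mono ?_
    rintro b S' ⟨hb, hfit', hag⟩
    have h0 : S'.reg 0 = S.reg 0 := hag 0 Nat.zero_lt_one
    simp only [Nat.zero_add] at hb
    cases b
    · simp only [Bool.false_eq_true, if_false]
      have hne : S.reg 0 ≠ leadingTrue w := fun h => by
        rw [h] at hb
        exact absurd (hb.2 (getElem?_leadingTrue w)) (by simp)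
      refine yields_incr n (hfit' 0 n.2) ⟨m - 1, by omega, hfit'.set _ ?_, ?_⟩
      · change S'.reg 0 + 1 ≤ _
        omega
      · change (S'.set 0 (S'.reg 0 + 1)).reg 0 + (m - 1) = _
        rw [reg_set_self]
        omega
    · simp only [if_true]
      have h1 : S'.reg 0 = leadingTrue w := by
        by_contra hne
        exact hb.1 rfl (getElem?_of_lt_leadingTrue (by omega))
      refine (hR w S' hfit' fun i hi => (hag i hi).trans_le (hle i hi)).mono ?_
      rintro b S'' ⟨hb', -, -⟩
      rw [hb', hL]
      refine hc w _ _ fun i hi => ?_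
      obtain rfl : i = 0 := by omega
      exact h1
  obtain ⟨b, S', hrun, hb⟩ := hmain
  have hrun' := (Runs.branch (B := main) (runs_setup (workspace_pos w)) hrun).toOfflineTM
    (within_store (workspace_pos w))
  refine ⟨⟨_, hrun'.1, rfl, ?_⟩, fun c hc i => (hrun'.2 c hc i).trans_le (workspace_le w)⟩
  rw [← hb]
  exact Sum.inr_injective.eq_iff

end Closure

/-! ### The encoding of an instance, and the reconfiguration problem -/

/-- The entry `(i, j)` of the adjacency matrix in the encoding `w` of an instance on `n` vertices. -/
def AdjAt (w : List Bool) (n i j : ℕ) : Prop := w[n + 1 + n * i + j]? = some true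

/-- Membership of `i` in the first vertex set in the encoding `w` of an instance on `n` vertices. -/
def SourceAt (w : List Bool) (n i : ℕ) : Prop := w[n + 1 + n * n + i]? = some true

/-- Membership of `i` in the second vertex set in the encoding `w` of an instance on `n`
vertices. -/
def TargetAt (w : List Bool) (n i : ℕ) : Prop := w[n + 1 + n * n + n + i]? = some true

/-- Global independent offensive alliances of the graph on `{0, …, n - 1}` with adjacency `adj`. -/
def AllianceBelow (n : ℕ) (adj : ℕ → ℕ → Prop) (M : ℕ → Prop) : Prop :=
  ∀ v < n, (M v → ∀ u < n, M u → ¬ adj v u) ∧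
    (¬ M v → {u | u < n ∧ adj v u ∧ ¬ M u}.ncard < {u | u < n ∧ adj v u ∧ M u}.ncard)

/-- The word `w`, which begins with `n` letters `true`, has the form of an encoding. -/
def WellFormed (w : List Bool) (n : ℕ) : Prop :=
  w[n]? = some false ∧ (w[n + n * n + n + n]? = some true ∨ w[n + n * n + n + n]? = some false) ∧
    (¬ w[n + 1 + n * n + n + n]? = some true ∧ ¬ w[n + 1 + n * n + n + n]? = some false) ∧
    ∀ i < n, ¬ AdjAt w n i i ∧ ∀ j < n, AdjAt w n i j → AdjAt w n j i

/-- The two vertex sets differ only in vertices of degree one. -/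
def DifferBelow (n : ℕ) (adj : ℕ → ℕ → Prop) (M M' : ℕ → Prop) : Prop :=
  ∀ v < n, (M v ↔ M' v) ∨ ∃ u < n, adj v u ∧ ∀ u' < n, adj v u' → u' = u

/-- The word `w` encodes a yes-instance on `n` vertices. -/
def YesInstance (w : List Bool) (n : ℕ) : Prop :=
  WellFormed w n ∧ AllianceBelow n (AdjAt w n) (SourceAt w n) ∧
    AllianceBelow n (AdjAt w n) (TargetAt w n) ∧
    DifferBelow n (AdjAt w n) (SourceAt w n) (TargetAt w n)

/-! ### The conditions for a yes-instance are tests -/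

section Tests

variable {l : ℕ}

/-- Registers below `l` hold at most `|w|`, so the address is at most `|w|^2 + 2|w| + 1`, below
`regBound w`. -/
theorem isTest_adjAt (hl : 0 < l) {i j : ℕ} (hi : i < l) (hj : j < l) :
    IsTest l fun w σ => AdjAt w (σ 0) (σ i) (σ j) := by
  refine (((((isTerm_zero.add_reg hl).add_one.add_mul hl hi).add_reg hj).letter
    (fun w σ h => ?_) true)).congr fun w σ => by simp only [AdjAt, Nat.zero_add]
  have h0 := h 0 hl
  have h1 := h i hi
  have h2 := h j hj
  have := Nat.mul_le_mul h0 h1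
  simp only [regBound]
  nlinarith

theorem isTest_sourceAt (hl : 0 < l) {i : ℕ} (hi : i < l) :
    IsTest l fun w σ => SourceAt w (σ 0) (σ i) := by
  refine (((((isTerm_zero.add_reg hl).add_one.add_mul hl hl).add_reg hi).letter
    (fun w σ h => ?_) true)).congr fun w σ => by simp only [SourceAt, Nat.zero_add]
  have h0 := h 0 hl
  have h1 := h i hi
  have := Nat.mul_le_mul h0 h0
  simp only [regBound]
  nlinarith

theorem isTest_targetAt (hl : 0 < l) {i : ℕ} (hi : i < l) :
    IsTest l fun w σ => TargetAt w (σ 0) (σ i) := by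
  refine ((((((isTerm_zero.add_reg hl).add_one.add_mul hl hl).add_reg hl).add_reg hi).letter
    (fun w σ h => ?_) true)).congr fun w σ => by simp only [TargetAt, Nat.zero_add]
  have h0 := h 0 hl
  have h1 := h i hi
  have := Nat.mul_le_mul h0 h0
  simp only [regBound]
  nlinarith

theorem isTest_wellFormed : IsTest 1 fun w σ => WellFormed w (σ 0) := by
  have t1 : IsTerm 1 fun σ => 0 + σ 0 := isTerm_zero.add_reg one_pos
  have t2 : IsTerm 1 fun σ => 0 + σ 0 + σ 0 * σ 0 + σ 0 + σ 0 :=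
    ((t1.add_mul one_pos one_pos).add_reg one_pos).add_reg one_pos
  have t3 : IsTerm 1 fun σ => 0 + σ 0 + 1 + σ 0 * σ 0 + σ 0 + σ 0 :=
    ((t1.add_one.add_mul one_pos one_pos).add_reg one_pos).add_reg one_pos
  have b3 : ∀ (w : List Bool) (σ : ℕ → ℕ), (∀ i < 1, σ i ≤ w.length) →
      0 + σ 0 + 1 + σ 0 * σ 0 + σ 0 + σ 0 ≤ regBound w := by
    intro w σ h
    have h0 := h 0 one_pos
    have := Nat.mul_le_mul h0 h0
    simp only [regBound]
    nlinarith
  have b2 : ∀ (w : List Bool) (σ : ℕ → ℕ), (∀ i < 1, σ i ≤ w.length) →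
      0 + σ 0 + σ 0 * σ 0 + σ 0 + σ 0 ≤ regBound w := fun w σ h => by
    have := b3 w σ h
    omega
  have b1 : ∀ (w : List Bool) (σ : ℕ → ℕ), (∀ i < 1, σ i ≤ w.length) →
      0 + σ 0 ≤ regBound w := fun w σ h => by
    have := b3 w σ h
    omega
  have hsymm : IsTest 2 fun w σ => ¬ AdjAt w (σ 0) (σ 1) (σ 1) ∧ ∀ j < σ 0,
      AdjAt w (σ 0) (σ 1) j → AdjAt w (σ 0) j (σ 1) :=
    ((isTest_adjAt two_pos one_lt_two one_lt_two).not.and (IsTest.ball two_pos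
      ((isTest_adjAt (i := 1) (j := 2) (by omega) (by omega) (by omega)).imp
        (isTest_adjAt (i := 2) (j := 1) (by omega) (by omega) (by omega))))).congr
      fun w σ => by simp
  refine ((t1.letter b1 false).and (((t2.letter b2 true).or (t2.letter b2 false)).and
    (((t3.letter b3 true).not.and (t3.letter b3 false).not).and (hsymm.ball one_pos)))).congr
    fun w σ => ?_
  simp [WellFormed]

/-- Stated for a general `M` to cover both vertex sets; `hM` ranges over `l` and `i` because
membership is tested for vertices in different registers. -/
theorem isTest_allianceBelow {M : List Bool → ℕ → ℕ → Prop}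
    (hM : ∀ {l i}, 0 < l → i < l → IsTest l fun w σ => M w (σ 0) (σ i)) :
    IsTest 1 fun w σ => AllianceBelow (σ 0) (AdjAt w (σ 0)) (M w (σ 0)) := by
  have hind : IsTest 2 fun w σ => M w (σ 0) (σ 1) → ∀ u < σ 0, M w (σ 0) u →
      ¬ AdjAt w (σ 0) (σ 1) u :=
    ((hM two_pos one_lt_two).imp (IsTest.ball two_pos
      ((hM (i := 2) (by omega) (by omega)).imp
        (isTest_adjAt (i := 1) (j := 2) (by omega) (by omega) (by omega)).not))).congr
      fun w σ => by simp
  -- Register `1` holds `v`. `IsTest.count_lt` with `l = 2` keeps its counters in registers `2` and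
  -- `3`, so the neighbour being counted is in register `4`.
  have hadj : IsTest 5 fun w σ => AdjAt w (σ 0) (σ 1) (σ 4) :=
    isTest_adjAt (by omega) (by omega) (by omega)
  have hmem : IsTest 5 fun w σ => M w (σ 0) (σ 4) := hM (by omega) (by omega)
  have hcount := IsTest.count_lt (l := 2) two_pos (hadj.and hmem.not) (hadj.and hmem)
    (fun w σ x y => by simp) (fun w σ x y => by simp)
  refine (IsTest.ball one_pos (hind.and ((hM two_pos one_lt_two).not.imp hcount))).congr
    fun w σ => ?_
  simp [AllianceBelow, countReg]

theorem isTest_differBelow : IsTest 1 fun w σ =>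
    DifferBelow (σ 0) (AdjAt w (σ 0)) (SourceAt w (σ 0)) (TargetAt w (σ 0)) := by
  -- Registers `1`, `2` and `3` hold `v`, its neighbour `u` and the competing neighbour `u'`.
  have hleaf := ((isTest_adjAt (l := 3) (i := 1) (j := 2) (by omega) (by omega) (by omega)).and
    (IsTest.ball (by omega) ((isTest_adjAt (l := 4) (i := 1) (j := 3) (by omega) (by omega)
      (by omega)).imp (isTest_eq (i := 3) (j := 2) (by omega) (by omega))))).bex two_pos
  refine (IsTest.ball one_pos ((((isTest_sourceAt two_pos one_lt_two).iff
    (isTest_targetAt two_pos one_lt_two))).or hleaf)).congr fun w σ => ?_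
  simp [DifferBelow]

theorem isTest_yesInstance : IsTest 1 fun w σ => YesInstance w (σ 0) :=
  isTest_wellFormed.and ((isTest_allianceBelow fun hl hi => isTest_sourceAt hl hi).and
    ((isTest_allianceBelow fun hl hi => isTest_targetAt hl hi).and isTest_differBelow))

end Tests

/-! ### Well formed words are exactly the encodings -/

section Encoding

variable {n : ℕ} {G : SimpleGraph (Fin n)} {A B : Set (Fin n)}

theorem length_encodeInstance : (encodeInstance G A B).length = n + 1 + n * n + n + n := by
  simp [encodeInstance]
  omega

theorem getElem?_append_of_length_eq {l l' : List Bool} {m i : ℕ} (h : l.length = m) :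
    (l ++ l')[m + i]? = l'[i]? := by
  rw [List.getElem?_append_right (by omega), h, Nat.add_sub_cancel_left]

open Classical in
theorem encodeInstance_get_adj (i j : Fin n) :
    (encodeInstance G A B)[n + 1 + n * i + j]? = some (decide (G.Adj i j)) := by
  have hlt : n * (i : ℕ) + j < n * n := by
    have := Nat.mul_le_mul_left n i.2
    rw [Nat.mul_succ] at this
    omega
  rw [encodeInstance, List.getElem?_append_left (by simp; omega),
    List.getElem?_append_left (by simp; omega), List.getElem?_append_right (by simp; omega),
    List.getElem?_ofFn]
  have hsub : n + 1 + n * i + j - (List.replicate n true ++ [false]).length = n * i + j := by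
    simp
    omega
  simp only [hsub, hlt, dite_true, Option.some.injEq]
  have hdiv : (⟨n * i + j, hlt⟩ : Fin (n * n)).divNat = i := by
    ext
    rw [Fin.coe_divNat]
    simp only
    rw [Nat.mul_add_div (by omega), Nat.div_eq_of_lt j.2, Nat.add_zero]
  have hmod : (⟨n * i + j, hlt⟩ : Fin (n * n)).modNat = j := by
    ext
    rw [Fin.coe_modNat]
    simp only
    rw [Nat.mul_add_mod, Nat.mod_eq_of_lt j.2]
  rw [hdiv, hmod]

open Classical in
theorem encodeInstance_get_source (i : Fin n) :
    (encodeInstance G A B)[n + 1 + n * n + i]? = some (decide (i ∈ A)) := by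
  rw [encodeInstance, List.getElem?_append_left (by simp; omega),
    getElem?_append_of_length_eq (by simp; omega), List.getElem?_ofFn]
  simp

open Classical in
theorem encodeInstance_get_target (i : Fin n) :
    (encodeInstance G A B)[n + 1 + n * n + n + i]? = some (decide (i ∈ B)) := by
  rw [encodeInstance, getElem?_append_of_length_eq (by simp; omega), List.getElem?_ofFn]
  simp

theorem encodeInstance_get_unary {i : ℕ} (hi : i < n) :
    (encodeInstance G A B)[i]? = some true := by
  rw [encodeInstance, List.getElem?_append_left (by simp; omega),
    List.getElem?_append_left (by simp; omega), List.getElem?_append_left (by simp; omega),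
    List.getElem?_append_left (by simpa), List.getElem?_replicate, if_pos hi]

theorem encodeInstance_get_separator : (encodeInstance G A B)[n]? = some false := by
  rw [encodeInstance, List.getElem?_append_left (by simp),
    List.getElem?_append_left (by simp), List.getElem?_append_left (by simp)]
  simp

theorem leadingTrue_eq {w : List Bool} {m : ℕ} (h : ∀ i < m, w[i]? = some true)
    (hm : w[m]? ≠ some true) : leadingTrue w = m := by
  rcases lt_trichotomy (leadingTrue w) m with hlt | heq | hgt
  · exact absurd (h _ hlt) (getElem?_leadingTrue w)
  · exact heq
  · exact absurd (getElem?_of_lt_leadingTrue hgt) hm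

/-- The separator `false` ends the unary block, so `n` can be read off the word. -/
theorem leadingTrue_encodeInstance : leadingTrue (encodeInstance G A B) = n :=
  leadingTrue_eq (fun _ => encodeInstance_get_unary) (by simp [encodeInstance_get_separator])

/-- A well formed word is the encoding of a graph with two vertex sets. -/
theorem WellFormed.exists_eq_encodeInstance {w : List Bool} (h : WellFormed w (leadingTrue w)) :
    ∃ (G : SimpleGraph (Fin (leadingTrue w))) (A B : Set (Fin (leadingTrue w))),
      w = encodeInstance G A B := by
  classical
  obtain ⟨hsep, hlast, hnone, hadj⟩ := h
  have hunary : ∀ i < leadingTrue w, w[i]? = some true := fun i hi =>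
    getElem?_of_lt_leadingTrue hi
  generalize leadingTrue w = n at hsep hlast hnone hadj hunary
  -- The letter at index `n + n * n + n + n` exists and the next one does not, which fixes the
  -- length.
  have hlen : w.length = n + 1 + n * n + n + n := by
    have h1 : n + n * n + n + n < w.length := by
      by_contra hle
      rw [List.getElem?_eq_none (by omega)] at hlast
      simp at hlast
    have h2 : w.length ≤ n + 1 + n * n + n + n := by
      by_contra hlt
      rw [List.getElem?_eq_getElem (by omega)] at hnone
      cases hx : w[n + 1 + n * n + n + n] <;> simp [hx] at hnone
    omega
  -- A Boolean letter is determined by whether it is `true`, which is what the encoding records.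
  have hbit : ∀ k < w.length, w[k]? = some (decide (w[k]? = some true)) := by
    intro k hk
    rw [List.getElem?_eq_getElem hk]
    cases w[k] <;> simp
  let G : SimpleGraph (Fin n) :=
    { Adj := fun i j => AdjAt w n i j
      symm := ⟨fun i j hij => (hadj i i.2).2 j j.2 hij⟩
      loopless := ⟨fun i => (hadj i i.2).1⟩ }
  refine ⟨G, {i | SourceAt w n i}, {i | TargetAt w n i}, List.ext_getElem? fun k => ?_⟩
  by_cases hk : k < w.length
  swap
  · rw [List.getElem?_eq_none (by omega),
      List.getElem?_eq_none (by rw [length_encodeInstance]; omega)]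
  rcases lt_trichotomy k n with h1 | rfl | h1
  · rw [hunary k h1, encodeInstance_get_unary h1]
  · rw [hsep, encodeInstance_get_separator]
  rw [hbit k hk]
  by_cases h2 : k < n + 1 + n * n
  · obtain ⟨r, rfl⟩ := Nat.exists_eq_add_of_le (show n + 1 ≤ k by omega)
    have hr : r < n * n := by omega
    have hn : 0 < n := Nat.pos_of_mul_pos_right (by omega : 0 < n * n)
    -- Row and column of the `r`-th matrix entry are the quotient and the remainder of `r` by `n`.
    have hi : r / n < n := Nat.div_lt_of_lt_mul hr
    have hj : r % n < n := Nat.mod_lt _ hn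
    have hidx : n + 1 + r = n + 1 + n * (⟨r / n, hi⟩ : Fin n) + (⟨r % n, hj⟩ : Fin n) := by
      have := Nat.div_add_mod r n
      simp only
      omega
    rw [hidx, encodeInstance_get_adj]
    exact congrArg some (decide_eq_decide.2 Iff.rfl)
  by_cases h3 : k < n + 1 + n * n + n
  · obtain ⟨r, rfl⟩ := Nat.exists_eq_add_of_le (show n + 1 + n * n ≤ k by omega)
    refine Eq.trans ?_ (encodeInstance_get_source (⟨r, by omega⟩ : Fin n)).symm
    exact congrArg some (decide_eq_decide.2 Iff.rfl)
  · obtain ⟨r, rfl⟩ := Nat.exists_eq_add_of_le (show n + 1 + n * n + n ≤ k by omega)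
    refine Eq.trans ?_ (encodeInstance_get_target (⟨r, by omega⟩ : Fin n)).symm
    exact congrArg some (decide_eq_decide.2 Iff.rfl)

theorem adjAt_encodeInstance (i j : Fin n) :
    AdjAt (encodeInstance G A B) n i j ↔ G.Adj i j := by
  simp [AdjAt, encodeInstance_get_adj]

theorem sourceAt_encodeInstance (i : Fin n) : SourceAt (encodeInstance G A B) n i ↔ i ∈ A := by
  simp [SourceAt, encodeInstance_get_source]

theorem targetAt_encodeInstance (i : Fin n) : TargetAt (encodeInstance G A B) n i ↔ i ∈ B := by
  simp [TargetAt, encodeInstance_get_target]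

theorem wellFormed_encodeInstance : WellFormed (encodeInstance G A B) n := by
  have hlen := length_encodeInstance (G := G) (A := A) (B := B)
  refine ⟨encodeInstance_get_separator, ?_, ?_, fun i hi => ⟨fun h => ?_, fun j hj h => ?_⟩⟩
  · rw [List.getElem?_eq_getElem (by omega)]
    generalize (encodeInstance G A B)[n + n * n + n + n]'_ = b
    cases b <;> simp
  · rw [List.getElem?_eq_none (by omega)]
    simp
  · exact G.irrefl ((adjAt_encodeInstance ⟨i, hi⟩ ⟨i, hi⟩).1 h)
  · exact (adjAt_encodeInstance ⟨j, hj⟩ ⟨i, hi⟩).2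
      ((adjAt_encodeInstance ⟨i, hi⟩ ⟨j, hj⟩).1 h).symm

theorem ncard_eq_ncard_below (s : Set (Fin n)) (p : ℕ → Prop) (h : ∀ i : Fin n, p i ↔ i ∈ s) :
    s.ncard = {k | k < n ∧ p k}.ncard := by
  rw [← Set.ncard_image_of_injective s Fin.val_injective]
  congr 1
  ext k
  constructor
  · rintro ⟨i, hi, rfl⟩
    exact ⟨i.2, (h i).2 hi⟩
  · rintro ⟨hk, hp⟩
    exact ⟨⟨k, hk⟩, (h ⟨k, hk⟩).1 hp, rfl⟩

theorem forall_lt_iff_forall_fin {p : ℕ → Prop} {q : Fin n → Prop} (h : ∀ i : Fin n, p i ↔ q i) :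
    (∀ k < n, p k) ↔ ∀ i, q i :=
  ⟨fun hp i => (h i).1 (hp i i.2), fun hq k hk => (h ⟨k, hk⟩).2 (hq ⟨k, hk⟩)⟩

theorem allianceBelow_iff {adj : ℕ → ℕ → Prop} {M : ℕ → Prop}
    (hadj : ∀ i j : Fin n, adj i j ↔ G.Adj i j) (hM : ∀ i : Fin n, M i ↔ i ∈ A) :
    AllianceBelow n adj M ↔ G.IsGlobalIndepOffensiveAlliance A := by
  rw [SimpleGraph.isGlobalIndepOffensiveAlliance_iff, AllianceBelow, ← forall_and]
  refine forall_lt_iff_forall_fin fun v => ?_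
  rw [and_comm]
  refine and_congr ?_ ?_
  · rw [SimpleGraph.degreeIn, SimpleGraph.degreeIn,
      ncard_eq_ncard_below _ (fun u => adj v u ∧ ¬ M u) fun u => by simp [hadj, hM],
      ncard_eq_ncard_below _ (fun u => adj v u ∧ M u) fun u => by simp [hadj, hM], hM]
  · rw [hM]
    refine imp_congr_right fun _ => forall_lt_iff_forall_fin fun u => ?_
    rw [hM, hadj]

theorem differBelow_iff {adj : ℕ → ℕ → Prop} {M M' : ℕ → Prop}
    (hadj : ∀ i j : Fin n, adj i j ↔ G.Adj i j) (hM : ∀ i : Fin n, M i ↔ i ∈ A)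
    (hM' : ∀ i : Fin n, M' i ↔ i ∈ B) : DifferBelow n adj M M' ↔ G.DifferOnLeaves A B := by
  rw [DifferBelow, SimpleGraph.DifferOnLeaves]
  refine forall_lt_iff_forall_fin fun v => ?_
  rw [hM, hM', Set.ncard_eq_one]
  refine or_congr_right ⟨?_, ?_⟩
  · rintro ⟨u, hu, hvu, huniq⟩
    refine ⟨⟨u, hu⟩, Set.eq_singleton_iff_unique_mem.2
      ⟨(hadj v ⟨u, hu⟩).1 hvu, fun x hx => Fin.ext (huniq x x.2 ((hadj v x).2 hx))⟩⟩
  · rintro ⟨u, hu⟩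
    obtain ⟨hvu, huniq⟩ := Set.eq_singleton_iff_unique_mem.1 hu
    exact ⟨u, u.2, (hadj v u).2 hvu, fun x hx hvx =>
      congrArg Fin.val (huniq ⟨x, hx⟩ ((hadj v ⟨x, hx⟩).1 hvx))⟩

theorem yesInstance_encodeInstance : YesInstance (encodeInstance G A B) n ↔
    G.IsGlobalIndepOffensiveAlliance A ∧ G.IsGlobalIndepOffensiveAlliance B ∧
      G.DifferOnLeaves A B := by
  rw [YesInstance, allianceBelow_iff adjAt_encodeInstance sourceAt_encodeInstance,
    allianceBelow_iff adjAt_encodeInstance targetAt_encodeInstance,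
    differBelow_iff adjAt_encodeInstance sourceAt_encodeInstance targetAt_encodeInstance]
  simp [wellFormed_encodeInstance]

end Encoding

/-- `YesInstance` does not mention `Y`: the leaf condition is necessary and sufficient under both
rules, so a single test decides both problems. -/
theorem mem_globalIndepOffReconfiguration_iff (Y : TokenRule) (w : List Bool) :
    w ∈ globalIndepOffReconfiguration Y ↔ YesInstance w (leadingTrue w) := by
  constructor
  · rintro ⟨n, G, A, B, rfl, hA, hB, h⟩
    rw [leadingTrue_encodeInstance, yesInstance_encodeInstance]
    exact ⟨hA, hB, h.differOnLeaves⟩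
  · intro h
    obtain ⟨G, A, B, hw⟩ := h.1.exists_eq_encodeInstance
    have h' : YesInstance (encodeInstance G A B) (leadingTrue w) := hw ▸ h
    obtain ⟨hA, hB, hdiff⟩ := yesInstance_encodeInstance.1 h'
    exact ⟨_, G, A, B, hw, hA, hB, hdiff.reconfigurable hA hB⟩

/-- Global independent offensive alliance reconfiguration is decidable in logarithmic space, both
under token jumping and under token sliding; and every token jump between two global independent
offensive alliances of a finite graph is along an isolated edge. -/
theorem mainTheorem6 :
    (∀ Y : TokenRule, InLogSpace (globalIndepOffReconfiguration Y)) ∧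
    (∀ (V : Type*) [Finite V] (G : SimpleGraph V) (A B : Set V),
      G.IsGlobalIndepOffensiveAlliance A → G.IsGlobalIndepOffensiveAlliance B →
      SimpleGraph.TokenJump A B → ∀ v ∈ A \ B, ∀ u ∈ B \ A, G.IsIsolatedEdge v u) := by
  refine ⟨fun Y => isTest_yesInstance.inLogSpace (mem_globalIndepOffReconfiguration_iff Y), ?_⟩
  intro V _ G A B hA hB h v hv u hu
  exact hA.isIsolatedEdge_of_tokenJump hB h hv hu
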